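/- **Setting.** Let $d\ge 1$ and let $\varphi$ be a probability distribution on $\mathbb R$, absolutely continuous with respect to Lebesgue measure, with $\mathbb E\,\mathsf u_i=0$, $\mathbb E\,\mathsf u_i^2=1$, $\mathbb E\,\mathsf u_i^3=0$, $r_4:=\mathbb E\,\mathsf u_i^4<\infty$ for $\mathsf u_i\sim\varphi$; write $\mathsf u=(\mathsf u_1,\dots,\mathsf u_d)\sim\varphi^{\otimes d}$. Let $\Lambda=\{\lambda=(m,C): m\in\mathbb R^d,\ C\in\mathbb R^{d\times d}\text{ diagonal},\ C\succ0\}$ with $\|\lambda\|_2^2=\|m\|_2^2+\|C\|_{\mathrm F}^2$, let $\mathcal T_\lambda(u)=Cu+m$, and let $q_\lambda$ be the law of $\mathcal T_\lambda(\mathsf u)$ (mean-field location-scale family). For $\ell:\mathbb R^d\to\mathbb R$ put $f(\lambda)=\mathbb E_{z\sim q_\lambda}\ell(z)$ and $F=f+h$, where $h:\Lambda\to\mathbb R\cup\{+\infty\}$, extended by $+\infty$ outside $\Lambda$, is proper, convex and lower semicontinuous on $\mathbb R^d\times\{\text{diagonal matrices}\}$. Stochastic proximal gradient descent (SPGD)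 with step sizes $\gamma_t>0$ from $\lambda_0\in\Lambda$ is $$\lambda_{t+1}=\operatorname{prox}_{\gamma_t h}\bigl(\lambda_t-\gamma_t\,\widehat{\nabla f}(\lambda_t;\mathsf u_t)\bigr),\quad \operatorname{prox}_{\gamma h}(x)=\operatorname*{argmin}_{\lambda\in\Lambda}\Bigl\{h(\lambda)+\tfrac1{2\gamma}\|x-\lambda\|_2^2\Bigr\},\quad \widehat{\nabla f}(\lambda;u)=\nabla_\lambda\,\ell(\mathcal T_\lambda(u)),$$ with $\mathsf u_0,\mathsf u_1,\dots$ i.i.d. from $\varphi^{\otimes d}$. For $\mu>0$, $\gamma_0>0$, $t_*\in\mathbb N$ the two-stage schedule is $\gamma_t=\gamma_0$ for $t\le t_*$ and $\gamma_t=\frac1\mu\frac{2t+1}{(t+1)^2}$ for $t\ge t_*+1$. For $H\in\mathbb R^{d\times d}$ and $\delta\ge0$ let $$g(d,H,\delta,\mu,\varphi)=2(1+r_4)\frac{\|H\|_2^2}{\mu^2}+4\frac{\delta^2}{\mu^2}\Bigl(\tfrac12+r_4+\mathbb E\max_{j\le d}\mathsf u_j^2\Bigr).$$ **Corollary.** There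 is an absolute constant $K>0$ such that the following holds for all data as above. Let $\ell$ be twice differentiable, $\mu$-strongly convex and $L$-smooth ($\mu,L>0$), and put $\kappa=L/\mu$, $H=\frac{L+\mu}2\mathrm I_d$, $\delta=\frac{L-\mu}2$. Then: 1. $\delta\ge0$, $\|\nabla^2\ell(z)-H\|_2\le\delta$ for all $z\in\mathbb R^d$, and $\mu\le\sigma_{\min}(H)\le\sigma_{\max}(H)\le L$. 2. $$g:=g(d,H,\delta,\mu,\varphi)=\tfrac12(1+r_4)(\kappa+1)^2+(\kappa-1)^2\Bigl(\tfrac12+r_4+\mathbb E\max_{j\le d}\mathsf u_j^2\Bigr).$$ 3. The minimizers defining $\operatorname{prox}_{\gamma h}(x)$ (all $\gamma>0$ and all $x$), $\lambda_*=(m_*,C_*)=\operatorname{argmin}_{\lambda\in\Lambda}F(\lambda)$ and $\bar z=\operatorname{argmin}_{z\in\mathbb R^d}\ell(z)$ exist and are unique. Put $\sigma_*^2=\|m_*-\bar z\|_2^2+\|C_*\|_{\mathrm F}^2$ and $\Delta=\|\lambda_0-\lambda_*\|_2$. There are $\mathcal L>0$ with $\mathbb E\|\widehat{\nabla f}(\lambda;\mathsf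 u)-\widehat{\nabla f}(\lambda';\mathsf u)\|_2^2\le\mathcal L^2\|\lambda-\lambda'\|_2^2$ for all $\lambda,\lambda'\in\Lambda$, a step size $0<\gamma_0\le\mu/(2\mathcal L^2)$ and a switching time $t_*$, none of them depending on $\varepsilon$ or $T$, such that SPGD with the two-stage schedule satisfies, with $\log^+x=\max(0,\log x)$, $$T\ \ge\ K\,g\,\Bigl(\frac{\sigma_*^2}{\varepsilon}+\frac{\sigma_*\log^+(\Delta^2/\sigma_*^2)}{\sqrt\varepsilon}+\log^+\frac{\Delta^2}{\varepsilon}+1\Bigr)\quad\Longrightarrow\quad\mathbb E\|\lambda_T-\lambda_*\|_2^2\le\varepsilon$$ for every $\varepsilon>0$ and $T\in\mathbb N$; and, for all sufficiently small $\varepsilon>0$ (how small may depend on the problem) and every $T\in\mathbb N$, $$T\ \ge\ K\,g\,\Bigl(\frac{\sigma_*^2}{\varepsilon}+\frac{\sigma_*\log(\Delta^2)}{\sqrt\varepsilon}\Bigr)\quad\Longrightarrow\quad\mathbb E\|\lambda_T-\lambda_*\|_2^2\le\varepsilon ,$$ where $\log(\Delta^2)$ is read as $0$ if $\Delta=0$.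 -/

import Mathlib

open MeasureTheory ProbabilityTheory Filter Topology

universe v

noncomputable section

namespace BBVI

/-- `ℝ^d` with the Euclidean norm. -/
abbrev E (d : ℕ) : Type := EuclideanSpace ℝ (Fin d)

/-- `ℝ^d × 𝔻^d`: a parameter `(m, C)` with location `m` and diagonal scale matrix `C`, the latter
stored as the vector of its diagonal entries. The norm is
`‖(m, C)‖₂² = ‖m‖₂² + ‖C‖_F²`. -/
abbrev Param (d : ℕ) : Type := WithLp 2 (E d × E d)

/-- The domain `Λ` of the linear parametrization: `C` is diagonal and positive definite. -/
def Lam (d : ℕ) : Set (Param d) := {lam | ∀ i, 0 < lam.snd i}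

/-- `x` is the only minimizer of `F` on `S`. -/
def IsUniqueArgmin {X Y : Type*} [Preorder Y] (F : X → Y) (S : Set X) (x : X) : Prop :=
  x ∈ S ∧ ∀ y ∈ S, y ≠ x → F x < F y

/-! ### Target function -/

/-- `μ`-strong convexity of a differentiable function. -/
def StronglyConvex {d : ℕ} (l : E d → ℝ) (μ : ℝ) : Prop :=
  Differentiable ℝ l ∧
    ∀ z z' : E d, l z - l z' + μ / 2 * ‖z - z'‖ ^ 2 ≤ inner ℝ (gradient l z) (z - z')

/-- `L`-Lipschitz smoothness of a differentiable function. -/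
def Smooth {d : ℕ} (l : E d → ℝ) (L : ℝ) : Prop :=
  Differentiable ℝ l ∧ ∀ z z' : E d, ‖gradient l z - gradient l z'‖ ≤ L * ‖z - z'‖

/-- Twice differentiable everywhere (the second derivative need not be continuous). -/
def TwiceDifferentiable {d : ℕ} (l : E d → ℝ) : Prop :=
  Differentiable ℝ l ∧ Differentiable ℝ (gradient l)

/-- The Hessian, as a linear operator. -/
def hessian {d : ℕ} (l : E d → ℝ) (z : E d) : E d →L[ℝ] E d := fderiv ℝ (gradient l) z

/-- A real matrix as an operator on Euclidean space; its norm is the spectral norm. -/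
def matOp {d : ℕ} (H : Matrix (Fin d) (Fin d) ℝ) : E d →L[ℝ] E d :=
  Matrix.toEuclideanCLM (n := Fin d) (𝕜 := ℝ) H

/-- `‖∇²ℓ(z) - H‖₂ ≤ δ` for all `z`. -/
def AlmostConstantHessian {d : ℕ} (l : E d → ℝ) (H : Matrix (Fin d) (Fin d) ℝ) (δ : ℝ) : Prop :=
  TwiceDifferentiable l ∧ 0 ≤ δ ∧ ∀ z : E d, ‖hessian l z - matOp H‖ ≤ δ

/-! ### Variational family -/

/-- The standing assumptions on the univariate base distribution `φ`. -/
structure IsBase (φ : Measure ℝ) : Prop where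
  prob : IsProbabilityMeasure φ
  ac : φ ≪ volume
  integrable_pow_four : Integrable (fun x : ℝ => x ^ 4) φ
  mean : ∫ x, x ∂φ = 0
  variance : ∫ x, x ^ 2 ∂φ = 1
  third : ∫ x, x ^ 3 ∂φ = 0

/-- The kurtosis `r₄`. -/
def r4 (φ : Measure ℝ) : ℝ := ∫ x, x ^ 4 ∂φ

/-- The law `φ^{⊗d}` of `u = (u₁, …, u_d)` with `u_i` i.i.d. from `φ`. -/
def noise (d : ℕ) (φ : Measure ℝ) : Measure (E d) :=
  (Measure.pi fun _ : Fin d => φ).map (WithLp.toLp 2)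

/-- `𝔼 max_j u_j²`. -/
def expMaxSq (d : ℕ) (φ : Measure ℝ) : ℝ := ∫ u, (⨆ j : Fin d, u j ^ 2) ∂(noise d φ)

/-- The reparametrization function `T_λ(u) = C u + m`. -/
def reparam {d : ℕ} (lam : Param d) (u : E d) : E d :=
  WithLp.toLp 2 fun i => lam.snd i * u i + lam.fst i

/-- The member `q_λ` of the mean-field location-scale family. -/
def q {d : ℕ} (φ : Measure ℝ) (lam : Param d) : Measure (E d) := (noise d φ).map (reparam lam)

/-! ### Objective -/

/-- `f(λ) = 𝔼_{z ∼ q_λ} ℓ(z)`. -/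
def f {d : ℕ} (l : E d → ℝ) (φ : Measure ℝ) (lam : Param d) : ℝ := ∫ z, l z ∂(q φ lam)

/-- `h : Λ → ℝ ∪ {+∞}`, extended by `+∞` outside `Λ`, is proper, convex and lower
semicontinuous. -/
structure IsRegularizer {d : ℕ} (h : Param d → EReal) : Prop where
  ne_bot : ∀ lam, h lam ≠ ⊥
  eq_top : ∀ lam, lam ∉ Lam d → h lam = ⊤
  proper : ∃ lam, h lam ≠ ⊤
  convex : ∀ x y : Param d, ∀ a b : ℝ, 0 ≤ a → 0 ≤ b → a + b = 1 →
    h (a • x + b • y) ≤ (a : EReal) * h x + (b : EReal) * h y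
  lsc : LowerSemicontinuous h

/-- `F = f + h`. -/
def F {d : ℕ} (l : E d → ℝ) (h : Param d → EReal) (φ : Measure ℝ) (lam : Param d) : EReal :=
  (f l φ lam : EReal) + h lam

/-! ### Stochastic proximal gradient descent -/

/-- The reparametrization gradient `∇_λ ℓ(T_λ(u))`. -/
def reparamGrad {d : ℕ} (l : E d → ℝ) (lam : Param d) (u : E d) : Param d :=
  gradient (fun lam' : Param d => l (reparam lam' u)) lam

/-- The function minimized by the proximal operator `prox_{γh}` at `x`. -/
def proxObj {d : ℕ} (h : Param d → EReal) (γ : ℝ) (x y : Param d) : EReal :=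
  h y + ((1 / (2 * γ) * ‖x - y‖ ^ 2 : ℝ) : EReal)

open Classical in
/-- `prox_{γh}(x) = argmin_{y ∈ Λ} h(y) + ‖x - y‖² / (2γ)` (and `x` if there is no
unique minimizer). -/
def prox {d : ℕ} (h : Param d → EReal) (γ : ℝ) (x : Param d) : Param d :=
  if hx : ∃ p, IsUniqueArgmin (proxObj h γ x) (Lam d) p then hx.choose else x

/-- The iterates `λ_t` driven by the noise sequence `u₀, u₁, …`. -/
def spgd {d : ℕ} (l : E d → ℝ) (h : Param d → EReal) (γ : ℕ → ℝ) (lam0 : Param d)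
    (u : ℕ → E d) : ℕ → Param d
  | 0 => lam0
  | t + 1 =>
      prox h (γ t) (spgd l h γ lam0 u t - γ t • reparamGrad l (spgd l h γ lam0 u t) (u t))

/-- The two-stage step size schedule with switching time `tstar`. -/
def stepSize (μ γ0 : ℝ) (tstar t : ℕ) : ℝ :=
  if t ≤ tstar then γ0 else 1 / μ * ((2 * t + 1) / ((t : ℝ) + 1) ^ 2)

/-- The reparametrization gradient is `𝓛`-Lipschitz in mean square on `Λ`. -/
def ExpectedSmooth {d : ℕ} (l : E d → ℝ) (φ : Measure ℝ) (Lc : ℝ) : Prop :=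
  ∀ lam ∈ Lam d, ∀ lam' ∈ Lam d,
    Integrable (fun u => ‖reparamGrad l lam u - reparamGrad l lam' u‖ ^ 2) (noise d φ) ∧
    ∫ u, ‖reparamGrad l lam u - reparamGrad l lam' u‖ ^ 2 ∂(noise d φ)
      ≤ Lc ^ 2 * ‖lam - lam'‖ ^ 2

/-! ### Complexity -/

/-- The complexity factor `g(d, H, δ, μ, φ)`. -/
def g (d : ℕ) (H : Matrix (Fin d) (Fin d) ℝ) (δ μ : ℝ) (φ : Measure ℝ) : ℝ :=
  2 * (1 + r4 φ) * (‖matOp H‖ ^ 2 / μ ^ 2)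
    + 4 * (δ ^ 2 / μ ^ 2) * (1 / 2 + r4 φ + expMaxSq d φ)

/-- `σ_*² = ‖m_* - z̄‖₂² + ‖C_*‖_F²`. -/
def sigmaSq {d : ℕ} (lamStar : Param d) (zbar : E d) : ℝ :=
  ‖lamStar.fst - zbar‖ ^ 2 + ‖lamStar.snd‖ ^ 2

/-- The guarantee `𝔼‖λ_T - λ_*‖₂² ≤ ε` for the iterates run with i.i.d. noise vectors of law
`φ^{⊗d}`, on every probability space. -/
def Guarantee {d : ℕ} (l : E d → ℝ) (h : Param d → EReal) (φ : Measure ℝ) (γ : ℕ → ℝ)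
    (lam0 lamStar : Param d) (T : ℕ) (ε : ℝ) : Prop :=
  ∀ (Ω : Type v) [MeasurableSpace Ω] (P : Measure Ω) [IsProbabilityMeasure P]
    (u : ℕ → Ω → E d), (∀ t, Measurable (u t)) → iIndepFun u P →
    (∀ t, P.map (u t) = noise d φ) →
    Integrable (fun ω => ‖spgd l h γ lam0 (fun t => u t ω) T - lamStar‖ ^ 2) P ∧
    ∫ ω, ‖spgd l h γ lam0 (fun t => u t ω) T - lamStar‖ ^ 2 ∂P ≤ ε

end BBVI

end

noncomputable section

namespace BBVI

/-! ### Minimization of a convex function plus a strongly convex smooth one -/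

/-! The analysis rests on one estimate: the reparametrization gradient is Lipschitz in mean square
with squared constant `μ² g`. Since `T_λ(u)` is linear in `λ`, this gradient is the adjoint of `λ ↦
T_λ(u)` applied to `∇ℓ`, which weights the square of coordinate `i` by `1 + u_i²`. The Hessian
spectrum lies in `[μ, L]`, so `∇ℓ` is `c • id`, with `c = (L + μ) / 2`, plus a `δ`-Lipschitz
remainder. The first part acts coordinatewise and costs only `r₄`. The remainder mixes coordinates
and costs `max_j u_j²`, but splitting off one coordinate and using independence bounds `𝔼 (max_j
u_j²) u_i²` by `r₄ + 𝔼 max_j u_j²` (`IsBase.integral_iSup_sq_mul_le`).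

The map `λ ↦ T_λ` is an isometry into `L²` of the noise, so `f` inherits the strong convexity of
`ℓ`. As `λ_*` is a fixed point of the exact proximal step and `prox` is nonexpansive, the mean
squared error obeys `r_{t+1} ≤ (1 - γμ) r_t + 2γ² μ² g σ_*²` whenever `2γμg ≤ 1`
(`MeanSquareLipschitz.integral_step_le`, `lintegral_spgd_le`). The noise scales with `σ_*²` because
the gradient vanishes identically at the degenerate parameter `(z̄, 0)`.

What remains is scalar. A constant step contracts the error to `2σ_*²` in order `g (1 +
log⁺(Δ²/σ_*²))` steps; the decreasing steps then make `t² r_t` telescope, up to an increment of at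
most `8 g σ_*²` per step (`errorBound_le_of_le`). -/

/-- `G` behaves like the gradient of `ψ`: the linearization error of `ψ` lies between
`μ / 2 * ‖y - x‖ ^ 2` and `M / 2 * ‖y - x‖ ^ 2`. -/
structure HasQuadraticBounds {X : Type*} [NormedAddCommGroup X] [InnerProductSpace ℝ X]
    (ψ : X → ℝ) (G : X → X) (μ M : ℝ) : Prop where
  lower : ∀ x y, ψ x + inner ℝ (G x) (y - x) + μ / 2 * ‖y - x‖ ^ 2 ≤ ψ y
  upper : ∀ x y, ψ y ≤ ψ x + inner ℝ (G x) (y - x) + M / 2 * ‖y - x‖ ^ 2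

/-- `v` is a subgradient at `p`, a point of the domain, of the convex function `h`. -/
def IsSubgradient {X : Type*} [NormedAddCommGroup X] [InnerProductSpace ℝ X]
    (h : X → EReal) (p v : X) : Prop :=
  ∃ r : ℝ, h p = r ∧ ∀ (y : X) (s : ℝ), h y = s → r + inner ℝ v (y - p) ≤ s

/-- Proper, convex, lower semicontinuous. -/
structure IsClosedConvex {X : Type*} [NormedAddCommGroup X] [InnerProductSpace ℝ X]
    (h : X → EReal) : Prop where
  ne_bot : ∀ x, h x ≠ ⊥
  proper : ∃ x, h x ≠ ⊤
  convex : ∀ x y : X, ∀ a b : ℝ, 0 ≤ a → 0 ≤ b → a + b = 1 →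
    h (a • x + b • y) ≤ (a : EReal) * h x + (b : EReal) * h y
  lsc : LowerSemicontinuous h

section Minimization

variable {X : Type*} [NormedAddCommGroup X] [InnerProductSpace ℝ X]
  {h : X → EReal} {ψ : X → ℝ} {G : X → X} {μ M : ℝ}

theorem IsClosedConvex.exists_real (hh : IsClosedConvex h) {x : X} (hx : h x ≠ ⊤) :
    ∃ r : ℝ, h x = r :=
  ⟨(h x).toReal, (EReal.coe_toReal hx (hh.ne_bot x)).symm⟩

theorem IsClosedConvex.exists_real_le_segment (hh : IsClosedConvex h) {x y : X} {r s : ℝ}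
    (hx : h x = r) (hy : h y = s) {θ : ℝ} (h0 : 0 ≤ θ) (h1 : θ ≤ 1) :
    ∃ t : ℝ, h (x + θ • (y - x)) = t ∧ t ≤ (1 - θ) * r + θ * s := by
  have key := hh.convex x y (1 - θ) θ (by linarith) h0 (by ring)
  have e : (1 - θ) • x + θ • y = x + θ • (y - x) := by module
  rw [e, hx, hy] at key
  have key' : h (x + θ • (y - x)) ≤ (((1 - θ) * r + θ * s : ℝ) : EReal) := by
    simpa only [EReal.coe_add, EReal.coe_mul] using key
  obtain ⟨t, ht⟩ := hh.exists_real (ne_top_of_le_ne_top (EReal.coe_ne_top _) key')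
  exact ⟨t, ht, by rw [ht] at key'; exact_mod_cast key'⟩

/-- Squeeze: at each `x` both bounds are continuous in `y` and equal `ψ x` at `y = x`. -/
theorem HasQuadraticBounds.continuous (hψ : HasQuadraticBounds ψ G μ M) : Continuous ψ := by
  rw [continuous_iff_continuousAt]
  intro x
  have lo : Tendsto (fun y => ψ x + inner ℝ (G x) (y - x) + μ / 2 * ‖y - x‖ ^ 2) (𝓝 x)
      (𝓝 (ψ x)) := by
    have : Continuous fun y => ψ x + inner ℝ (G x) (y - x) + μ / 2 * ‖y - x‖ ^ 2 := by fun_prop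
    simpa using this.tendsto x
  have hi : Tendsto (fun y => ψ x + inner ℝ (G x) (y - x) + M / 2 * ‖y - x‖ ^ 2) (𝓝 x)
      (𝓝 (ψ x)) := by
    have : Continuous fun y => ψ x + inner ℝ (G x) (y - x) + M / 2 * ‖y - x‖ ^ 2 := by fun_prop
    simpa using this.tendsto x
  exact tendsto_of_tendsto_of_tendsto_of_le_of_le lo hi (hψ.lower x) (hψ.upper x)

theorem HasQuadraticBounds.strongly_monotone (hψ : HasQuadraticBounds ψ G μ M) (x y : X) :
    μ * ‖x - y‖ ^ 2 ≤ inner ℝ (G x - G y) (x - y) := by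
  have h1 := hψ.lower x y
  have h2 := hψ.lower y x
  have e : inner ℝ (G x) (y - x) = - inner ℝ (G x) (x - y) := by
    rw [← inner_neg_right, neg_sub]
  rw [e, norm_sub_rev y x] at h1
  rw [inner_sub_left]
  linarith

theorem nonneg_of_forall_add_mul_nonneg {A B : ℝ} (hAB : ∀ θ : ℝ, 0 < θ → θ ≤ 1 → 0 ≤ A + θ * B) :
    0 ≤ A := by
  have ht : Tendsto (fun θ : ℝ => A + θ * B) (𝓝[>] 0) (𝓝 A) := by
    have : Continuous fun θ : ℝ => A + θ * B := by fun_prop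
    simpa using (this.tendsto 0).mono_left nhdsWithin_le_nhds
  refine ge_of_tendsto ht ?_
  filter_upwards [Ioc_mem_nhdsGT (zero_lt_one' ℝ)] with θ hθ using hAB θ hθ.1 hθ.2

/-- A minimizer of `h + ψ` satisfies the first order condition. -/
theorem IsClosedConvex.isSubgradient_of_isMin (hh : IsClosedConvex h)
    (hψ : HasQuadraticBounds ψ G μ M) {p : X} (hp : h p ≠ ⊤)
    (hmin : ∀ y, h p + ψ p ≤ h y + ψ y) : IsSubgradient h p (-G p) := by
  obtain ⟨r, hr⟩ := hh.exists_real hp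
  refine ⟨r, hr, fun y s hs => ?_⟩
  have : 0 ≤ s - r + inner ℝ (G p) (y - p) := by
    -- Move from `p` a fraction `θ` towards `y`: convexity makes the change of `h` at most linear in
    -- `θ`, and the error of linearizing `ψ` is at most `O(θ²)`. Divide by `θ` and let it tend to
    -- `0`.
    refine nonneg_of_forall_add_mul_nonneg (B := M / 2 * ‖y - p‖ ^ 2) fun θ h0 h1 => ?_
    obtain ⟨t, ht, htle⟩ := hh.exists_real_le_segment hr hs h0.le h1
    have h2 := hmin (p + θ • (y - p))
    rw [hr, ht] at h2
    have h2' : r + ψ p ≤ t + ψ (p + θ • (y - p)) := by exact_mod_cast h2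
    have h3 := hψ.upper p (p + θ • (y - p))
    rw [add_sub_cancel_left, inner_smul_right, norm_smul, Real.norm_of_nonneg h0.le] at h3
    have h4 : 0 ≤ θ * (s - r + inner ℝ (G p) (y - p) + θ * (M / 2 * ‖y - p‖ ^ 2)) := by
      nlinarith
    exact nonneg_of_mul_nonneg_right h4 h0
  rw [inner_neg_left]
  linarith

/-- Direct method for `h + ψ`. Although `h` may be unbounded below, its minimum over a unit ball and
convexity along rays force at most linear decay outside that ball, which the quadratic growth of `ψ`
overcomes. A minimizer over a large ball is then global. -/
theorem IsClosedConvex.exists_isSubgradient [ProperSpace X] (hh : IsClosedConvex h)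
    (hψ : HasQuadraticBounds ψ G μ M) (hμ : 0 < μ) : ∃ p, IsSubgradient h p (-G p) := by
  obtain ⟨x₀, hx₀⟩ := hh.proper
  obtain ⟨r₀, hr₀⟩ := hh.exists_real hx₀
  obtain ⟨a, ha, hamin⟩ := LowerSemicontinuousOn.exists_isMinOn
    (Metric.nonempty_closedBall.2 zero_le_one) (isCompact_closedBall x₀ 1)
    (hh.lsc.lowerSemicontinuousOn _)
  have hax : h a ≤ h x₀ := hamin (Metric.mem_closedBall_self zero_le_one)
  obtain ⟨m, hm⟩ := hh.exists_real (ne_top_of_le_ne_top hx₀ hax)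
  have hm0 : m ≤ r₀ := by rw [hm, hr₀] at hax; exact_mod_cast hax
  -- Beyond this radius the quadratic term dominates both linear losses, `r₀ - m` from `h` and `‖G
  -- x₀‖` from `ψ`. The summand `1` keeps such points outside the unit ball on which `m` is the
  -- minimum.
  set R := 1 + 2 * (r₀ - m + ‖G x₀‖) / μ with hR
  have hR1 : 1 ≤ R := by
    have : 0 ≤ 2 * (r₀ - m + ‖G x₀‖) / μ := by
      have := norm_nonneg (G x₀)
      have : 0 ≤ r₀ - m + ‖G x₀‖ := by linarith
      positivity
    linarith
  have hlsc : LowerSemicontinuous fun y => h y + (ψ y : EReal) :=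
    hh.lsc.add' (continuous_coe_real_ereal.comp hψ.continuous).lowerSemicontinuous
      fun x => EReal.continuousAt_add (.inr (EReal.coe_ne_bot _)) (.inr (EReal.coe_ne_top _))
  obtain ⟨p, -, hpmin⟩ := LowerSemicontinuousOn.exists_isMinOn
    (Metric.nonempty_closedBall.2 (zero_le_one.trans hR1)) (isCompact_closedBall x₀ R)
    (hlsc.lowerSemicontinuousOn _)
  have hp0 : h p + ψ p ≤ h x₀ + ψ x₀ :=
    hpmin (Metric.mem_closedBall_self (zero_le_one.trans hR1))
  have hptop : h p ≠ ⊤ := by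
    intro htop
    rw [htop, EReal.top_add_coe, hr₀, ← EReal.coe_add, top_le_iff] at hp0
    exact EReal.coe_ne_top _ hp0
  refine ⟨p, hh.isSubgradient_of_isMin hψ hptop fun y => ?_⟩
  by_cases hy : y ∈ Metric.closedBall x₀ R
  · exact hpmin hy
  refine hp0.trans ?_
  by_cases hyt : h y = ⊤
  · rw [hyt, EReal.top_add_coe]; exact le_top
  obtain ⟨s, hs⟩ := hh.exists_real hyt
  rw [Metric.mem_closedBall, not_le, dist_eq_norm] at hy
  have hn1 : 1 < ‖y - x₀‖ := lt_of_le_of_lt hR1 hy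
  have hn0 : 0 < ‖y - x₀‖ := by linarith
  -- With `θ = ‖y - x₀‖⁻¹` the segment from `x₀` to `y` is evaluated where it leaves the unit ball.
  obtain ⟨t, ht, htle⟩ := hh.exists_real_le_segment hr₀ hs (inv_nonneg.2 hn0.le)
    (inv_le_one_of_one_le₀ hn1.le)
  have hmt : m ≤ t := by
    have hmem : x₀ + ‖y - x₀‖⁻¹ • (y - x₀) ∈ Metric.closedBall x₀ 1 := by
      rw [Metric.mem_closedBall, dist_eq_norm, add_sub_cancel_left, norm_smul, norm_inv, norm_norm,
        inv_mul_cancel₀ hn0.ne']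
    have := hamin hmem
    simp only [Set.mem_ofPred_eq, hm, ht] at this
    exact_mod_cast this
  have hlow := hψ.lower x₀ y
  have hinner := neg_le_of_abs_le (abs_real_inner_le_norm (G x₀) (y - x₀))
  have h5 : ‖y - x₀‖ * (m - r₀) ≤ s - r₀ := by
    have h6 : m ≤ (1 - ‖y - x₀‖⁻¹) * r₀ + ‖y - x₀‖⁻¹ * s := hmt.trans htle
    have h7 := mul_le_mul_of_nonneg_left h6 hn0.le
    have h8 : ‖y - x₀‖ * ((1 - ‖y - x₀‖⁻¹) * r₀ + ‖y - x₀‖⁻¹ * s)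
        = ‖y - x₀‖ * r₀ + (s - r₀) := by
      field_simp
      ring
    linarith
  have h9 : r₀ - m + ‖G x₀‖ ≤ μ / 2 * ‖y - x₀‖ := by
    have : 2 * (r₀ - m + ‖G x₀‖) / μ ≤ ‖y - x₀‖ := by linarith
    rw [div_le_iff₀ hμ] at this
    linarith
  have h10 := mul_le_mul_of_nonneg_right h9 hn0.le
  have : r₀ + ψ x₀ ≤ s + ψ y := by nlinarith
  rw [hr₀, hs]
  exact_mod_cast this

/-- Points satisfying the first order condition are strict minimizers. -/
theorem IsClosedConvex.lt_of_isSubgradient (hh : IsClosedConvex h)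
    (hψ : HasQuadraticBounds ψ G μ M) (hμ : 0 < μ) {p : X} (hp : IsSubgradient h p (-G p))
    {y : X} (hy : y ≠ p) : h p + ψ p < h y + ψ y := by
  obtain ⟨r, hr, hsub⟩ := hp
  rw [hr, ← EReal.coe_add]
  by_cases hyt : h y = ⊤
  · rw [hyt, EReal.top_add_coe]
    exact EReal.coe_lt_top _
  obtain ⟨s, hs⟩ := hh.exists_real hyt
  have h1 := hsub y s hs
  have h2 := hψ.lower p y
  have h3 : 0 < μ / 2 * ‖y - p‖ ^ 2 := by
    have : 0 < ‖y - p‖ := norm_pos_iff.2 (sub_ne_zero.2 hy)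
    positivity
  rw [inner_neg_left] at h1
  have : r + ψ p < s + ψ y := by linarith
  rw [hs]
  exact_mod_cast this

theorem IsSubgradient.monotone {p p' v v' : X} (hp : IsSubgradient h p v)
    (hp' : IsSubgradient h p' v') : 0 ≤ inner ℝ (v - v') (p - p') := by
  obtain ⟨r, hr, hsub⟩ := hp
  obtain ⟨r', hr', hsub'⟩ := hp'
  have h1 := hsub p' r' hr'
  have h2 := hsub' p r hr
  rw [← neg_sub p p', inner_neg_right] at h1
  rw [inner_sub_left]
  linarith

/-- Resolvents of subdifferentials are nonexpansive. -/
theorem IsSubgradient.norm_sub_le {p p' x x' : X} {γ : ℝ} (hγ : 0 < γ)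
    (hp : IsSubgradient h p (γ⁻¹ • (x - p))) (hp' : IsSubgradient h p' (γ⁻¹ • (x' - p'))) :
    ‖p - p'‖ ≤ ‖x - x'‖ := by
  have h1 := hp.monotone hp'
  rw [← smul_sub, inner_smul_left] at h1
  have h2 : 0 ≤ inner ℝ (x - p - (x' - p')) (p - p') :=
    nonneg_of_mul_nonneg_right h1 (by simpa using hγ)
  have e : x - p - (x' - p') = (x - x') - (p - p') := by abel
  rw [e, inner_sub_left, real_inner_self_eq_norm_sq] at h2
  have h3 := real_inner_le_norm (x - x') (p - p')
  by_contra hlt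
  push Not at hlt
  nlinarith [norm_nonneg (x - x'), norm_nonneg (p - p')]

end Minimization

/-! ### The proximal operator -/

section Prox

variable {d : ℕ} {h : Param d → EReal}

theorem IsRegularizer.isClosedConvex (hh : IsRegularizer h) : IsClosedConvex h :=
  ⟨hh.ne_bot, hh.proper, hh.convex, hh.lsc⟩

theorem IsUniqueArgmin.unique {X Y : Type*} [Preorder Y] {F : X → Y} {S : Set X} {x y : X}
    (hx : IsUniqueArgmin F S x) (hy : IsUniqueArgmin F S y) : x = y := by
  by_contra hne
  exact lt_asymm (hx.2 y hy.1 (Ne.symm hne)) (hy.2 x hx.1 hne)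

/-- Minimality holds on the whole space. Positive definiteness of the minimizer is automatic, since
`h` is finite there and infinite off `Λ`. -/
theorem IsRegularizer.isUniqueArgmin (hh : IsRegularizer h) {ψ : Param d → ℝ}
    {G : Param d → Param d} {μ M : ℝ} (hψ : HasQuadraticBounds ψ G μ M) (hμ : 0 < μ)
    {p : Param d} (hp : IsSubgradient h p (-G p)) :
    IsUniqueArgmin (fun y => h y + (ψ y : EReal)) (Lam d) p := by
  refine ⟨?_, fun y _ hy => hh.isClosedConvex.lt_of_isSubgradient hψ hμ hp hy⟩
  by_contra hpL
  obtain ⟨r, hr, -⟩ := hp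
  rw [hh.eq_top p hpL] at hr
  exact EReal.coe_ne_top _ hr.symm

/-- The linearization error of a quadratic is exact, so both constants agree. The proximal problem
thus falls under the same existence and uniqueness lemmas as the minimization of `F`. -/
theorem hasQuadraticBounds_dist_sq {X : Type*} [NormedAddCommGroup X] [InnerProductSpace ℝ X]
    (γ : ℝ) (x : X) :
    HasQuadraticBounds (fun y => 1 / (2 * γ) * ‖x - y‖ ^ 2) (fun y => γ⁻¹ • (y - x)) γ⁻¹ γ⁻¹ := by
  have key : ∀ y z : X, 1 / (2 * γ) * ‖x - y‖ ^ 2 + inner ℝ (γ⁻¹ • (y - x)) (z - y)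
      + γ⁻¹ / 2 * ‖z - y‖ ^ 2 = 1 / (2 * γ) * ‖x - z‖ ^ 2 := by
    intro y z
    have e : x - z = (x - y) - (z - y) := by abel
    rw [e, norm_sub_sq_real (x - y), inner_smul_left, ← neg_sub x y, inner_neg_left]
    simp only [conj_trivial]
    ring
  exact ⟨fun y z => (key y z).le, fun y z => (key y z).ge⟩

theorem IsRegularizer.prox_spec (hh : IsRegularizer h) {γ : ℝ} (hγ : 0 < γ) (x : Param d) :
    IsUniqueArgmin (proxObj h γ x) (Lam d) (prox h γ x) ∧
      IsSubgradient h (prox h γ x) (γ⁻¹ • (x - prox h γ x)) := by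
  have hq := hasQuadraticBounds_dist_sq γ x
  have hγ' : 0 < γ⁻¹ := inv_pos.2 hγ
  obtain ⟨p, hp⟩ := hh.isClosedConvex.exists_isSubgradient hq hγ'
  have harg : IsUniqueArgmin (proxObj h γ x) (Lam d) p := hh.isUniqueArgmin hq hγ' hp
  have hex : ∃ p, IsUniqueArgmin (proxObj h γ x) (Lam d) p := ⟨p, harg⟩
  have hprox : IsUniqueArgmin (proxObj h γ x) (Lam d) (prox h γ x) := by
    rw [prox, dif_pos hex]
    exact hex.choose_spec
  refine ⟨hprox, ?_⟩
  rw [hprox.unique harg, ← neg_sub p x, smul_neg]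
  exact hp

theorem IsRegularizer.norm_prox_sub_le (hh : IsRegularizer h) {γ : ℝ} (hγ : 0 < γ)
    (x x' : Param d) : ‖prox h γ x - prox h γ x'‖ ≤ ‖x - x'‖ :=
  (hh.prox_spec hγ x).2.norm_sub_le hγ (hh.prox_spec hγ x').2

theorem IsRegularizer.continuous_prox (hh : IsRegularizer h) {γ : ℝ} (hγ : 0 < γ) :
    Continuous (prox h γ) :=
  (LipschitzWith.of_dist_le_mul (K := 1) fun x y => by
    simpa [dist_eq_norm] using hh.norm_prox_sub_le hγ x y).continuous

/-- A point with `-v ∈ ∂h(p)` is a fixed point of the proximal gradient step with gradient `v`. -/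
theorem IsRegularizer.norm_prox_sub_le_of_isSubgradient (hh : IsRegularizer h) {γ : ℝ}
    (hγ : 0 < γ) {p v : Param d} (hp : IsSubgradient h p (-v)) (x : Param d) :
    ‖prox h γ x - p‖ ≤ ‖x - (p - γ • v)‖ := by
  refine (hh.prox_spec hγ x).2.norm_sub_le hγ ?_
  -- This makes `p` itself the resolvent at `p - γ • v`, so nonexpansiveness compares two proximal
  -- points.
  have : γ⁻¹ • (p - γ • v - p) = -v := by
    rw [sub_sub_cancel_left, smul_neg, smul_smul, inv_mul_cancel₀ hγ.ne', one_smul]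
  rwa [this]

end Prox

/-! ### The target function -/

section Target

variable {d : ℕ} {l : E d → ℝ} {μ L : ℝ}

/-- The upper bound needs no integration along segments: strong convexity based at `y`, then
Cauchy–Schwarz for the gradient difference, gives the error `L * ‖y - x‖ ^ 2`. The resulting
constant `2 * L` is not sharp, but the convergence rate does not involve it. -/
theorem StronglyConvex.hasQuadraticBounds (hc : StronglyConvex l μ) (hμ : 0 < μ)
    (hs : Smooth l L) : HasQuadraticBounds l (gradient l) μ (2 * L) := by
  have lower : ∀ x y, l x + inner ℝ (gradient l x) (y - x) + μ / 2 * ‖y - x‖ ^ 2 ≤ l y := by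
    intro x y
    have := hc.2 x y
    rw [← neg_sub y x, inner_neg_right, norm_neg] at this
    linarith
  refine ⟨lower, fun x y => ?_⟩
  have h1 := hc.2 y x
  have h2 := real_inner_le_norm (gradient l y - gradient l x) (y - x)
  have h3 := mul_le_mul_of_nonneg_right (hs.2 y x) (norm_nonneg (y - x))
  rw [inner_sub_left] at h2
  have : 0 ≤ μ / 2 * ‖y - x‖ ^ 2 := by positivity
  nlinarith

theorem Smooth.continuous_gradient (hs : Smooth l L) (hL : 0 < L) : Continuous (gradient l) :=
  (LipschitzWith.of_dist_le_mul (K := ⟨L, hL.le⟩) fun x y => by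
    simp only [dist_eq_norm]; exact hs.2 x y).continuous

theorem StronglyConvex.le_of_smooth (hc : StronglyConvex l μ) (hμ : 0 < μ) (hs : Smooth l L)
    (hd : 0 < d) : μ ≤ L := by
  have hm := (hc.hasQuadraticBounds hμ hs).strongly_monotone (EuclideanSpace.single ⟨0, hd⟩ 1) 0
  have h2 := real_inner_le_norm (gradient l (EuclideanSpace.single ⟨0, hd⟩ 1) - gradient l 0)
    (EuclideanSpace.single ⟨0, hd⟩ 1 - 0)
  have h3 := hs.2 (EuclideanSpace.single ⟨0, hd⟩ 1) 0
  simp only [sub_zero, PiLp.norm_single, norm_one] at hm h2 h3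
  linarith

/-- The case `h = 0` of the general minimization; the subgradient inequality tested at `z - gradient
l z` forces the gradient to vanish. -/
theorem StronglyConvex.exists_isUniqueArgmin (hc : StronglyConvex l μ) (hμ : 0 < μ)
    (hs : Smooth l L) : ∃ z, IsUniqueArgmin l Set.univ z ∧ gradient l z = 0 := by
  have hq := hc.hasQuadraticBounds hμ hs
  have hzero : IsClosedConvex (fun _ : E d => (0 : EReal)) :=
    ⟨by simp, by simp, by simp, lowerSemicontinuous_const⟩
  obtain ⟨z, hz⟩ := hzero.exists_isSubgradient hq hμ
  refine ⟨z, ⟨trivial, fun y _ hy => ?_⟩, ?_⟩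
  · have := hzero.lt_of_isSubgradient hq hμ hz hy
    simp only [zero_add] at this
    exact_mod_cast this
  · obtain ⟨r, hr, hsub⟩ := hz
    have hr0 : r = 0 := EReal.coe_eq_zero.1 hr.symm
    have := hsub (z - gradient l z) 0 (by simp)
    rw [hr0, sub_sub_cancel_left, inner_neg_neg, real_inner_self_eq_norm_sq, zero_add] at this
    have h0 : ‖gradient l z‖ = 0 := by nlinarith [norm_nonneg (gradient l z)]
    exact norm_eq_zero.1 h0

/-! ### The Hessian and its deviation from the midpoint matrix -/

/-- A symmetric operator is bounded by its numerical radius. -/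
theorem opNorm_le_of_abs_inner_self_le {X : Type*} [NormedAddCommGroup X]
    [InnerProductSpace ℝ X] {A : X →L[ℝ] X} {C : ℝ} (hC : 0 ≤ C)
    (hsymm : ∀ v w, inner ℝ (A v) w = inner ℝ (A w) v)
    (hA : ∀ v, |inner ℝ (A v) v| ≤ C * ‖v‖ ^ 2) : ‖A‖ ≤ C := by
  -- Polarization on unit vectors: `4⟨Ax, y⟩ = ⟨A(x+y), x+y⟩ - ⟨A(x-y), x-y⟩`, and the parallelogram
  -- law bounds the right-hand side by `4C`.
  refine ContinuousLinearMap.opNorm_le_of_re_inner_le hC fun x y hx hy => ?_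
  have h1 := le_of_abs_le (hA (x + y))
  have h2 := neg_le_of_abs_le (hA (x - y))
  have h3 := parallelogram_law_with_norm ℝ x y
  have h4 := hsymm y x
  simp only [map_add, map_sub, inner_add_left, inner_add_right, inner_sub_left,
    inner_sub_right] at h1 h2
  rw [hx, hy] at h3
  simp only [RCLike.re_to_real]
  have h5 : C * (‖x + y‖ ^ 2) + C * ‖x - y‖ ^ 2 = 4 * C := by
    have : ‖x + y‖ ^ 2 + ‖x - y‖ ^ 2 = 4 := by nlinarith
    rw [← mul_add, this, mul_comm]
  linarith

/-- Symmetry of second derivatives requires only differentiability of the first derivative at the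
point, not a continuous Hessian. The Riesz isomorphism carries the gradient to `fderiv`. -/
theorem TwiceDifferentiable.hessian_symm (h2 : TwiceDifferentiable l) (z v w : E d) :
    inner ℝ (hessian l z v) w = inner ℝ (hessian l z w) v := by
  have hd : HasFDerivAt (fderiv ℝ l)
      ((InnerProductSpace.toDual ℝ (E d)).toContinuousLinearEquiv.toContinuousLinearMap ∘L
        hessian l z) z := by
    have h3 : HasFDerivAt (gradient l) (hessian l z) z := (h2.2 z).hasFDerivAt
    have h4 := (InnerProductSpace.toDual ℝ (E d)).toContinuousLinearEquiv.toContinuousLinearMap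
      |>.hasFDerivAt.comp z h3
    refine h4.congr_of_eventuallyEq (Eventually.of_forall fun y => ?_)
    simp [gradient]
  have := second_derivative_symmetric (fun y => (h2.1 y).hasFDerivAt) hd v w
  simpa using this

/-- Divide the strong monotonicity of the gradient between `z + t • v` and `z` by `t²` and let `t`
decrease to `0`. -/
theorem hessian_inner_self_ge (hc : StronglyConvex l μ) (hμ : 0 < μ) (hs : Smooth l L)
    (h2 : TwiceDifferentiable l) (z v : E d) :
    μ * ‖v‖ ^ 2 ≤ inner ℝ (hessian l z v) v := by
  have hlim : Tendsto (fun t : ℝ => t⁻¹ • (gradient l (z + t • v) - gradient l z)) (𝓝[>] 0)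
      (𝓝 (hessian l z v)) := by
    have h3 : HasFDerivAt (gradient l) (hessian l z) z := (h2.2 z).hasFDerivAt
    have := (h3.hasLineDerivAt v).tendsto_slope_zero_right
    simpa using this
  have hlim' := hlim.inner (𝕜 := ℝ) (tendsto_const_nhds (x := v))
  refine ge_of_tendsto hlim' ?_
  filter_upwards [self_mem_nhdsWithin] with t ht
  have ht : 0 < t := ht
  have hm := (hc.hasQuadraticBounds hμ hs).strongly_monotone (z + t • v) z
  rw [add_sub_cancel_left, norm_smul, inner_smul_right, Real.norm_of_nonneg ht.le] at hm
  rw [inner_smul_left]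
  simp only [conj_trivial]
  rw [inv_mul_eq_div, le_div_iff₀ ht]
  refine le_of_mul_le_mul_left ?_ ht
  calc _ = μ * (t * ‖v‖) ^ 2 := by ring
    _ ≤ _ := hm

theorem norm_hessian_le (hL : 0 < L) (hs : Smooth l L) (z : E d) : ‖hessian l z‖ ≤ L :=
  norm_fderiv_le_of_lip' ℝ hL.le (Eventually.of_forall fun x => hs.2 x z)

theorem matOp_smul_one_apply (c : ℝ) (v : E d) :
    matOp (c • (1 : Matrix (Fin d) (Fin d) ℝ)) v = c • v := by
  rw [matOp, map_smul, map_one]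
  rfl

theorem norm_matOp_smul_one (hd : 0 < d) {c : ℝ} (hc : 0 ≤ c) :
    ‖matOp (c • (1 : Matrix (Fin d) (Fin d) ℝ))‖ = c := by
  have : Nonempty (Fin d) := ⟨⟨0, hd⟩⟩
  rw [matOp, map_smul, map_one, norm_smul, norm_one, mul_one, Real.norm_of_nonneg hc]

/-- The quadratic form of the Hessian lies in `[μ, L]` on unit vectors. Subtracting the midpoint
leaves values within the half-length of that interval, and symmetry turns this into a norm bound. -/
theorem almostConstantHessian_midpoint (hd : 0 < d) (hμ : 0 < μ) (hL : 0 < L)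
    (hc : StronglyConvex l μ) (hs : Smooth l L) (h2 : TwiceDifferentiable l) :
    AlmostConstantHessian l (((L + μ) / 2) • (1 : Matrix (Fin d) (Fin d) ℝ)) ((L - μ) / 2) := by
  have hδ : 0 ≤ (L - μ) / 2 := by linarith [hc.le_of_smooth hμ hs hd]
  refine ⟨h2, hδ, fun z => opNorm_le_of_abs_inner_self_le hδ ?_ ?_⟩
  · intro v w
    simp only [sub_apply, matOp_smul_one_apply, inner_sub_left,
      inner_smul_left, real_inner_comm w v, h2.hessian_symm z v w]
  · intro v
    simp only [sub_apply, matOp_smul_one_apply, inner_sub_left,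
      inner_smul_left, real_inner_self_eq_norm_sq, conj_trivial]
    have h3 := hessian_inner_self_ge hc hμ hs h2 z v
    have h4 := real_inner_le_norm (hessian l z v) v
    have h5 := (hessian l z).le_of_opNorm_le (norm_hessian_le hL hs z) v
    have h6 := mul_le_mul_of_nonneg_right h5 (norm_nonneg v)
    rw [abs_le]
    constructor <;> nlinarith

/-- The gradient deviates from a multiple of the identity by a `(L - μ) / 2`-Lipschitz map. -/
theorem norm_gradient_sub_smul_le (hd : 0 < d) (hμ : 0 < μ) (hL : 0 < L)
    (hc : StronglyConvex l μ) (hs : Smooth l L) (h2 : TwiceDifferentiable l) (z z' : E d) :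
    ‖gradient l z - gradient l z' - ((L + μ) / 2) • (z - z')‖ ≤ (L - μ) / 2 * ‖z - z'‖ := by
  have hH := almostConstantHessian_midpoint hd hμ hL hc hs h2
  -- The mean value inequality is applied to `∇ℓ - H`, whose derivative has norm at most `δ`.
  have hder : ∀ x ∈ Set.univ, HasFDerivWithinAt
      (fun x => gradient l x - matOp (((L + μ) / 2) • (1 : Matrix (Fin d) (Fin d) ℝ)) x)
      (hessian l x - matOp (((L + μ) / 2) • (1 : Matrix (Fin d) (Fin d) ℝ))) Set.univ x := by
    intro x _
    exact ((h2.2 x).hasFDerivAt.sub (ContinuousLinearMap.hasFDerivAt _)).hasFDerivWithinAt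
  have := Convex.norm_image_sub_le_of_norm_hasFDerivWithin_le hder (fun x _ => hH.2.2 x)
    convex_univ (Set.mem_univ z') (Set.mem_univ z)
  simp only [matOp_smul_one_apply] at this
  have e : gradient l z - gradient l z' - ((L + μ) / 2) • (z - z')
      = gradient l z - ((L + μ) / 2) • z - (gradient l z' - ((L + μ) / 2) • z') := by
    module
  rw [e]
  exact this

theorem g_midpoint (hd : 0 < d) (hμ : 0 < μ) (hL : 0 < L) (φ : Measure ℝ) :
    g d (((L + μ) / 2) • (1 : Matrix (Fin d) (Fin d) ℝ)) ((L - μ) / 2) μ φ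
      = 1 / 2 * (1 + r4 φ) * (L / μ + 1) ^ 2
          + (L / μ - 1) ^ 2 * (1 / 2 + r4 φ + expMaxSq d φ) := by
  rw [g, norm_matOp_smul_one hd (by positivity)]
  field_simp
  ring

end Target

/-! ### Moments of the noise -/

section Moments

variable {d : ℕ} {φ : Measure ℝ}

theorem IsBase.integrable_pow (hφ : IsBase φ) {k : ℕ} (hk : k ≤ 4) :
    Integrable (fun x : ℝ => x ^ k) φ := by
  have := hφ.prob
  refine ((integrable_const (1 : ℝ)).add hφ.integrable_pow_four).mono'
    (by fun_prop) (Eventually.of_forall fun x => ?_)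
  simp only [Pi.add_apply, norm_pow, Real.norm_eq_abs]
  rw [← Even.pow_abs (by decide : Even 4) x]
  rcases le_total |x| 1 with h | h
  · exact (pow_le_one₀ (abs_nonneg x) h).trans (by linarith [pow_nonneg (abs_nonneg x) 4])
  · exact (pow_le_pow_right₀ h hk).trans (by linarith)

/-- Integrate `(x² - 1)² ≥ 0`. -/
theorem IsBase.one_le_r4 (hφ : IsBase φ) : 1 ≤ r4 φ := by
  have := hφ.prob
  have h2 := hφ.integrable_pow (k := 2) (by norm_num)
  have h4 := hφ.integrable_pow_four
  have : ∫ x, (2 * x ^ 2 - 1) ∂φ ≤ ∫ x, x ^ 4 ∂φ :=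
    integral_mono ((h2.const_mul 2).sub (integrable_const 1)) h4
      fun x => by nlinarith [sq_nonneg (x ^ 2 - 1)]
  rw [integral_sub (h2.const_mul 2) (integrable_const 1), integral_const_mul, hφ.variance] at this
  rw [r4]
  simp at this
  linarith

theorem IsBase.isProbabilityMeasure_noise (hφ : IsBase φ) (d : ℕ) :
    IsProbabilityMeasure (noise d φ) := by
  have := hφ.prob
  exact Measure.isProbabilityMeasure_map (by fun_prop)

theorem map_ofLp_noise (φ : Measure ℝ) (d : ℕ) :
    (noise d φ).map (fun u i => u i) = Measure.pi fun _ : Fin d => φ := by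
  rw [noise, Measure.map_map (by fun_prop) (by fun_prop)]
  exact Measure.map_id

theorem IsBase.map_eval_noise (hφ : IsBase φ) (i : Fin d) :
    (noise d φ).map (fun u => u i) = φ := by
  have := hφ.prob
  have h := (measurePreserving_eval (fun _ : Fin d => φ) i).map_eq
  rw [← map_ofLp_noise φ d, Measure.map_map (by fun_prop) (by fun_prop)] at h
  exact h

theorem IsBase.integrable_coord_pow (hφ : IsBase φ) (i : Fin d) {k : ℕ} (hk : k ≤ 4) :
    Integrable (fun u : E d => u i ^ k) (noise d φ) := by
  have h := hφ.integrable_pow hk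
  rw [← hφ.map_eval_noise i] at h
  exact h.comp_measurable (by fun_prop)

theorem IsBase.integral_coord_pow (hφ : IsBase φ) (i : Fin d) (k : ℕ) :
    ∫ u : E d, u i ^ k ∂(noise d φ) = ∫ x, x ^ k ∂φ := by
  conv_rhs => rw [← hφ.map_eval_noise i]
  rw [integral_map (by fun_prop) (by fun_prop)]

theorem IsBase.iIndepFun_coord (hφ : IsBase φ) :
    iIndepFun (fun (i : Fin d) (u : E d) => u i) (noise d φ) := by
  have := hφ.isProbabilityMeasure_noise d
  rw [iIndepFun_iff_map_fun_eq_pi_map (fun i => by fun_prop), map_ofLp_noise]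
  simp only [hφ.map_eval_noise]

theorem measurable_iSup_sq : Measurable fun u : E d => ⨆ j, u j ^ 2 :=
  Measurable.iSup fun j => by fun_prop

theorem sq_le_iSup_sq (u : E d) (i : Fin d) : u i ^ 2 ≤ ⨆ j, u j ^ 2 :=
  le_ciSup (f := fun j => u j ^ 2) (Set.finite_range _).bddAbove i

theorem iSup_sq_nonneg (u : E d) : 0 ≤ ⨆ j, u j ^ 2 :=
  Real.iSup_nonneg fun j => sq_nonneg (u j)

theorem iSup_sq_sq_le (u : E d) : (⨆ j, u j ^ 2) ^ 2 ≤ ∑ j, u j ^ 4 := by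
  refine (Real.le_sqrt (iSup_sq_nonneg u) (Finset.sum_nonneg fun j _ => by positivity)).1
    (Real.iSup_le (fun j => ?_) (Real.sqrt_nonneg _))
  refine Real.le_sqrt_of_sq_le ?_
  calc (u j ^ 2) ^ 2 = u j ^ 4 := by ring
    _ ≤ _ := Finset.single_le_sum (f := fun j => u j ^ 4) (fun k _ => by positivity)
      (Finset.mem_univ j)

theorem IsBase.integrable_iSup_sq_sq (hφ : IsBase φ) :
    Integrable (fun u : E d => (⨆ j, u j ^ 2) ^ 2) (noise d φ) := by
  refine (integrable_finsetSum Finset.univ fun j _ =>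
    hφ.integrable_coord_pow j le_rfl).mono' (measurable_iSup_sq.pow_const 2).aestronglyMeasurable
    (Eventually.of_forall fun u => ?_)
  rw [Real.norm_of_nonneg (sq_nonneg _)]
  exact iSup_sq_sq_le u

theorem IsBase.integrable_iSup_sq (hφ : IsBase φ) :
    Integrable (fun u : E d => ⨆ j, u j ^ 2) (noise d φ) := by
  have := hφ.isProbabilityMeasure_noise d
  refine ((integrable_const (1 : ℝ)).add hφ.integrable_iSup_sq_sq).mono'
    measurable_iSup_sq.aestronglyMeasurable (Eventually.of_forall fun u => ?_)
  rw [Real.norm_of_nonneg (iSup_sq_nonneg u), Pi.add_apply]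
  nlinarith [sq_nonneg ((⨆ j, u j ^ 2) - 1), iSup_sq_nonneg u]

theorem IsBase.integrable_iSup_sq_mul (hφ : IsBase φ) (i : Fin d) :
    Integrable (fun u : E d => (⨆ j, u j ^ 2) * u i ^ 2) (noise d φ) := by
  refine hφ.integrable_iSup_sq_sq.mono'
    (measurable_iSup_sq.mul (by fun_prop)).aestronglyMeasurable (Eventually.of_forall fun u => ?_)
  rw [Real.norm_of_nonneg (mul_nonneg (iSup_sq_nonneg u) (sq_nonneg _)), sq (⨆ j, u j ^ 2)]
  exact mul_le_mul_of_nonneg_left (sq_le_iSup_sq u i) (iSup_sq_nonneg u)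

theorem expMaxSq_nonneg : 0 ≤ expMaxSq d φ :=
  integral_nonneg fun u => iSup_sq_nonneg u

/-- The maximum is at most `u_i²` plus the maximum `N` over the other coordinates. The first term
yields `r₄`; `N` is independent of `u_i`, which has unit variance, so `𝔼 N u_i² = 𝔼 N`. -/
theorem IsBase.integral_iSup_sq_mul_le (hφ : IsBase φ) (i : Fin d) :
    ∫ u : E d, (⨆ j, u j ^ 2) * u i ^ 2 ∂(noise d φ) ≤ r4 φ + expMaxSq d φ := by
  set T : Finset (Fin d) := Finset.univ.erase i with hT
  -- For `d = 1` the index type is empty and the real supremum is `0`, so no separate case is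
  -- needed.
  set N : E d → ℝ := fun u => ⨆ j : T, u j ^ 2 with hN
  have hNmeas : Measurable N := Measurable.iSup fun j => by fun_prop
  have hN0 : ∀ u, 0 ≤ N u := fun u => Real.iSup_nonneg fun j => sq_nonneg _
  have hNle : ∀ u, N u ≤ ⨆ j, u j ^ 2 := fun u =>
    Real.iSup_le (fun j => sq_le_iSup_sq u j) (iSup_sq_nonneg u)
  have hle : ∀ u : E d, (⨆ j, u j ^ 2) ≤ u i ^ 2 + N u := by
    intro u
    refine Real.iSup_le (fun j => ?_) (add_nonneg (sq_nonneg _) (hN0 u))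
    by_cases hj : j = i
    · rw [hj]; linarith [hN0 u]
    · have : u j ^ 2 ≤ N u := le_ciSup (f := fun j : T => u j ^ 2) (Set.finite_range _).bddAbove
        ⟨j, by simp [hT, hj]⟩
      linarith [sq_nonneg (u i)]
  have hNint : Integrable N (noise d φ) :=
    hφ.integrable_iSup_sq.mono' hNmeas.aestronglyMeasurable
      (Eventually.of_forall fun u => by rw [Real.norm_of_nonneg (hN0 u)]; exact hNle u)
  have hind : IndepFun N (fun u : E d => u i ^ 2) (noise d φ) := by
    have h := hφ.iIndepFun_coord.indepFun_finset T {i} (by simp [hT]) (fun j => by fun_prop)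
    exact h.comp (φ := fun w : T → ℝ => ⨆ j, w j ^ 2)
      (ψ := fun w : ({i} : Finset (Fin d)) → ℝ => w ⟨i, by simp⟩ ^ 2)
      (Measurable.iSup fun j => by fun_prop) (by fun_prop)
  have hprod : ∫ u, N u * u i ^ 2 ∂(noise d φ) = ∫ u, N u ∂(noise d φ) := by
    have h := hind.integral_mul_eq_mul_integral hNmeas.aestronglyMeasurable
      (by fun_prop)
    rw [hφ.integral_coord_pow i 2, hφ.variance, mul_one] at h
    exact h
  have hprodint : Integrable (fun u => N u * u i ^ 2) (noise d φ) :=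
    (hφ.integrable_iSup_sq_mul i).mono' (hNmeas.mul (by fun_prop)).aestronglyMeasurable
      (Eventually.of_forall fun u => by
        rw [Real.norm_of_nonneg (mul_nonneg (hN0 u) (sq_nonneg _))]
        exact mul_le_mul_of_nonneg_right (hNle u) (sq_nonneg _))
  calc ∫ u : E d, (⨆ j, u j ^ 2) * u i ^ 2 ∂(noise d φ)
      ≤ ∫ u : E d, (u i ^ 4 + N u * u i ^ 2) ∂(noise d φ) := by
        refine integral_mono (hφ.integrable_iSup_sq_mul i)
          ((hφ.integrable_coord_pow i le_rfl).add hprodint) fun u => ?_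
        have := mul_le_mul_of_nonneg_right (hle u) (sq_nonneg (u i))
        simp only
        nlinarith
    _ = r4 φ + ∫ u, N u ∂(noise d φ) := by
        rw [integral_add (hφ.integrable_coord_pow i le_rfl) hprodint, hφ.integral_coord_pow i 4,
          hprod, r4]
    _ ≤ _ := by
        gcongr
        exact integral_mono hNint hφ.integrable_iSup_sq hNle

theorem IsBase.integrable_affine_sq (hφ : IsBase φ) (i : Fin d) (a b : ℝ) :
    Integrable (fun u : E d => (b * u i + a) ^ 2) (noise d φ) := by
  have := hφ.isProbabilityMeasure_noise d
  have h1 := (hφ.integrable_coord_pow i (k := 1) (by norm_num)).const_mul (2 * a * b)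
  have h2 := (hφ.integrable_coord_pow i (k := 2) (by norm_num)).const_mul (b ^ 2)
  refine ((h2.add h1).add (integrable_const (a ^ 2))).congr (Eventually.of_forall fun u => ?_)
  simp only [Pi.add_apply]
  ring

theorem IsBase.integral_affine_sq (hφ : IsBase φ) (i : Fin d) (a b : ℝ) :
    ∫ u : E d, (b * u i + a) ^ 2 ∂(noise d φ) = a ^ 2 + b ^ 2 := by
  have := hφ.isProbabilityMeasure_noise d
  have h1 := (hφ.integrable_coord_pow i (k := 1) (by norm_num)).const_mul (2 * a * b)
  have h2 := (hφ.integrable_coord_pow i (k := 2) (by norm_num)).const_mul (b ^ 2)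
  calc ∫ u : E d, (b * u i + a) ^ 2 ∂(noise d φ)
      = ∫ u : E d, (b ^ 2 * u i ^ 2 + 2 * a * b * u i ^ 1 + a ^ 2) ∂(noise d φ) := by
        congr 1; ext u; ring
    _ = b ^ 2 * 1 + 2 * a * b * 0 + a ^ 2 := by
        rw [integral_add (h2.fun_add h1) (integrable_const _), integral_add h2 h1, integral_const_mul,
          integral_const_mul, hφ.integral_coord_pow i 2, hφ.integral_coord_pow i 1, hφ.variance]
        simp [hφ.mean]
    _ = _ := by ring

theorem IsBase.integrable_sq_mul_affine_sq (hφ : IsBase φ) (i : Fin d) (a b : ℝ) :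
    Integrable (fun u : E d => u i ^ 2 * (b * u i + a) ^ 2) (noise d φ) := by
  have h2 := (hφ.integrable_coord_pow i (k := 2) (by norm_num)).const_mul (a ^ 2)
  have h3 := (hφ.integrable_coord_pow i (k := 3) (by norm_num)).const_mul (2 * a * b)
  have h4 := (hφ.integrable_coord_pow i (k := 4) (by norm_num)).const_mul (b ^ 2)
  refine ((h4.add h3).add h2).congr (Eventually.of_forall fun u => ?_)
  simp only [Pi.add_apply]
  ring

/-- The vanishing third moment removes the cross term `2ab u_i³`. -/
theorem IsBase.integral_sq_mul_affine_sq (hφ : IsBase φ) (i : Fin d) (a b : ℝ) :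
    ∫ u : E d, u i ^ 2 * (b * u i + a) ^ 2 ∂(noise d φ) = a ^ 2 + r4 φ * b ^ 2 := by
  have h2 := (hφ.integrable_coord_pow i (k := 2) (by norm_num)).const_mul (a ^ 2)
  have h3 := (hφ.integrable_coord_pow i (k := 3) (by norm_num)).const_mul (2 * a * b)
  have h4 := (hφ.integrable_coord_pow i (k := 4) (by norm_num)).const_mul (b ^ 2)
  calc ∫ u : E d, u i ^ 2 * (b * u i + a) ^ 2 ∂(noise d φ)
      = ∫ u : E d, (b ^ 2 * u i ^ 4 + 2 * a * b * u i ^ 3 + a ^ 2 * u i ^ 2) ∂(noise d φ) := by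
        congr 1; ext u; ring
    _ = b ^ 2 * r4 φ + 2 * a * b * 0 + a ^ 2 * 1 := by
        rw [integral_add (h4.fun_add h3) h2, integral_add h4 h3, integral_const_mul,
          integral_const_mul, integral_const_mul, hφ.integral_coord_pow i 2,
          hφ.integral_coord_pow i 3, hφ.integral_coord_pow i 4, hφ.variance, hφ.third, r4]
    _ = _ := by ring

theorem IsBase.integrable_iSup_sq_mul_affine_sq (hφ : IsBase φ) (i : Fin d) (a b : ℝ) :
    Integrable (fun u : E d => (⨆ j, u j ^ 2) * (b * u i + a) ^ 2) (noise d φ) := by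
  refine ((hφ.integrable_iSup_sq.const_mul (2 * a ^ 2)).add
    ((hφ.integrable_iSup_sq_mul i).const_mul (2 * b ^ 2))).mono'
    (measurable_iSup_sq.mul (by fun_prop)).aestronglyMeasurable (Eventually.of_forall fun u => ?_)
  have h0 := iSup_sq_nonneg u
  rw [Real.norm_of_nonneg (mul_nonneg h0 (sq_nonneg _)), Pi.add_apply]
  have := mul_nonneg h0 (sq_nonneg (b * u i - a))
  nlinarith

/-- The cross term `𝔼 (max_j u_j²) u_i` need not vanish, so `(bu + a)² ≤ 2a² + 2b²u²` is used at the
cost of a factor `2`. -/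
theorem IsBase.integral_iSup_sq_mul_affine_sq_le (hφ : IsBase φ) (i : Fin d) (a b : ℝ) :
    ∫ u : E d, (⨆ j, u j ^ 2) * (b * u i + a) ^ 2 ∂(noise d φ)
      ≤ 2 * (r4 φ + expMaxSq d φ) * (a ^ 2 + b ^ 2) := by
  have h1 := hφ.integrable_iSup_sq.const_mul (2 * a ^ 2) (μ := noise d φ)
  have h2 := (hφ.integrable_iSup_sq_mul i).const_mul (2 * b ^ 2)
  calc ∫ u : E d, (⨆ j, u j ^ 2) * (b * u i + a) ^ 2 ∂(noise d φ)
      ≤ ∫ u : E d, (2 * a ^ 2 * (⨆ j, u j ^ 2) + 2 * b ^ 2 * ((⨆ j, u j ^ 2) * u i ^ 2))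
          ∂(noise d φ) := by
        refine integral_mono (hφ.integrable_iSup_sq_mul_affine_sq i a b) (h1.add h2) fun u => ?_
        have := mul_nonneg (iSup_sq_nonneg u) (sq_nonneg (b * u i - a))
        simp only
        nlinarith
    _ = 2 * a ^ 2 * expMaxSq d φ
          + 2 * b ^ 2 * ∫ u : E d, (⨆ j, u j ^ 2) * u i ^ 2 ∂(noise d φ) := by
        rw [integral_add h1 h2, integral_const_mul, integral_const_mul, expMaxSq]
    _ ≤ 2 * a ^ 2 * (r4 φ + expMaxSq d φ) + 2 * b ^ 2 * (r4 φ + expMaxSq d φ) := by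
        gcongr
        · linarith [hφ.one_le_r4]
        · exact hφ.integral_iSup_sq_mul_le i
    _ = _ := by ring

end Moments

/-! ### The reparametrization gradient -/

section Reparam

variable {d : ℕ} {l : E d → ℝ} {φ : Measure ℝ} {μ L : ℝ}

@[simp] theorem reparam_apply (lam : Param d) (u : E d) (i : Fin d) :
    reparam lam u i = lam.snd i * u i + lam.fst i := rfl

theorem continuous_reparam : Continuous fun p : Param d × E d => reparam p.1 p.2 := by
  unfold reparam
  fun_prop

/-- The reparametrization function as a continuous linear map of the parameter. -/
def reparamCLM (u : E d) : Param d →L[ℝ] E d where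
  toFun lam := reparam lam u
  map_add' x y := by
    ext i
    simp only [reparam_apply, WithLp.add_fst, WithLp.add_snd, PiLp.add_apply]
    ring
  map_smul' c x := by
    ext i
    simp only [reparam_apply, WithLp.smul_fst, WithLp.smul_snd, PiLp.smul_apply, smul_eq_mul,
      RingHom.id_apply]
    ring
  cont := continuous_reparam.comp (by fun_prop : Continuous fun lam : Param d => (lam, u))

theorem reparamCLM_apply (u : E d) (lam : Param d) : reparamCLM u lam = reparam lam u := rfl

theorem reparam_sub (lam lam' : Param d) (u : E d) :
    reparam lam u - reparam lam' u = reparam (lam - lam') u := by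
  simp only [← reparamCLM_apply, map_sub]

theorem norm_reparam_sq (lam : Param d) (u : E d) :
    ‖reparam lam u‖ ^ 2 = ∑ i, (lam.snd i * u i + lam.fst i) ^ 2 := by
  simp [EuclideanSpace.real_norm_sq_eq]

theorem norm_param_sq (lam : Param d) :
    ‖lam‖ ^ 2 = ∑ i, (lam.fst i ^ 2 + lam.snd i ^ 2) := by
  rw [WithLp.prod_norm_sq_eq_of_L2, EuclideanSpace.real_norm_sq_eq,
    EuclideanSpace.real_norm_sq_eq, Finset.sum_add_distrib]

theorem IsBase.integrable_norm_reparam_sq (hφ : IsBase φ) (lam : Param d) :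
    Integrable (fun u => ‖reparam lam u‖ ^ 2) (noise d φ) := by
  simp only [norm_reparam_sq]
  exact integrable_finsetSum _ fun i _ => hφ.integrable_affine_sq i _ _

/-- Zero mean and unit variance make `λ ↦ T_λ` an isometry into `L²`; hence `f` has the same
quadratic constants as `ℓ`. -/
theorem IsBase.integral_norm_reparam_sq (hφ : IsBase φ) (lam : Param d) :
    ∫ u, ‖reparam lam u‖ ^ 2 ∂(noise d φ) = ‖lam‖ ^ 2 := by
  simp only [norm_reparam_sq]
  rw [integral_finsetSum _ fun i _ => hφ.integrable_affine_sq i _ _, norm_param_sq]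
  exact Finset.sum_congr rfl fun i _ => hφ.integral_affine_sq i _ _

theorem reparamGrad_eq (hl : Differentiable ℝ l) (lam : Param d) (u : E d) :
    reparamGrad l lam u = WithLp.toLp 2 (gradient l (reparam lam u),
      WithLp.toLp 2 fun i => u i * gradient l (reparam lam u) i) := by
  refine HasGradientAt.gradient ?_
  rw [hasGradientAt_iff_hasFDerivAt]
  have h1 : HasFDerivAt l (InnerProductSpace.toDual ℝ (E d) (gradient l (reparam lam u)))
      (reparamCLM u lam) := (hl _).hasGradientAt.hasFDerivAt
  have h2 := h1.comp lam (reparamCLM u).hasFDerivAt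
  refine h2.congr_fderiv ?_
  ext v
  simp only [ContinuousLinearMap.comp_apply, InnerProductSpace.toDual_apply_apply,
    WithLp.prod_inner_apply, reparamCLM_apply, PiLp.inner_apply, ← Finset.sum_add_distrib]
  refine Finset.sum_congr rfl fun i _ => ?_
  simp
  ring

/-- Adjointness: it turns linearizations of `ℓ` at `T_λ(u)` into linearizations in the parameter. -/
theorem inner_reparamGrad (hl : Differentiable ℝ l) (lam v : Param d) (u : E d) :
    inner ℝ (reparamGrad l lam u) v = inner ℝ (gradient l (reparam lam u)) (reparam v u) := by
  rw [reparamGrad_eq hl]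
  simp only [WithLp.prod_inner_apply, PiLp.inner_apply, ← Finset.sum_add_distrib]
  refine Finset.sum_congr rfl fun i _ => ?_
  simp
  ring

theorem continuous_reparamGrad (hs : Smooth l L) (hL : 0 < L) :
    Continuous fun p : Param d × E d => reparamGrad l p.1 p.2 := by
  have h := (hs.continuous_gradient hL).comp (continuous_reparam (d := d))
  have h' : ∀ i, Continuous fun p : Param d × E d => gradient l (reparam p.1 p.2) i :=
    fun i => (PiLp.continuous_apply 2 _ i).comp h
  simp only [reparamGrad_eq hs.1]
  refine (WithLp.prod_continuous_toLp 2 _ _).comp (h.prodMk ?_)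
  refine (PiLp.continuous_toLp 2 _).comp (continuous_pi fun i => ?_)
  exact (by fun_prop : Continuous fun p : Param d × E d => p.2 i).mul (h' i)

theorem norm_reparamGrad_sub_sq (hl : Differentiable ℝ l) (lam lam' : Param d) (u : E d) :
    ‖reparamGrad l lam u - reparamGrad l lam' u‖ ^ 2
      = ∑ i, (1 + u i ^ 2)
          * (gradient l (reparam lam u) - gradient l (reparam lam' u)) i ^ 2 := by
  rw [norm_param_sq, reparamGrad_eq hl, reparamGrad_eq hl]
  refine Finset.sum_congr rfl fun i _ => ?_
  simp
  ring

/-- The pointwise bound on gradient differences behind expected smoothness. -/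
theorem norm_reparamGrad_sub_sq_le (hl : Differentiable ℝ l) {c δ : ℝ}
    (hgrad : ∀ z z', ‖gradient l z - gradient l z' - c • (z - z')‖ ≤ δ * ‖z - z'‖)
    (lam lam' : Param d) (u : E d) :
    ‖reparamGrad l lam u - reparamGrad l lam' u‖ ^ 2
      ≤ ∑ i, (2 * c ^ 2 * ((reparam (lam - lam') u i) ^ 2 + u i ^ 2 * (reparam (lam - lam') u i) ^ 2)
          + 2 * δ ^ 2 * ((reparam (lam - lam') u i) ^ 2
            + (⨆ j, u j ^ 2) * (reparam (lam - lam') u i) ^ 2)) := by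
  set w := reparam (lam - lam') u with hw
  set y := gradient l (reparam lam u) - gradient l (reparam lam' u) with hy
  have hr : ‖y - c • w‖ ≤ δ * ‖w‖ := by
    have := hgrad (reparam lam u) (reparam lam' u)
    rwa [reparam_sub] at this
  have hr2 : ∑ i, (y i - c * w i) ^ 2 ≤ δ ^ 2 * ∑ i, w i ^ 2 := by
    have h1 := pow_le_pow_left₀ (norm_nonneg _) hr 2
    rw [mul_pow, EuclideanSpace.real_norm_sq_eq, EuclideanSpace.real_norm_sq_eq] at h1
    simpa using h1
  rw [norm_reparamGrad_sub_sq hl]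
  -- Write `y = c w + (y - c w)`. The diagonal part keeps its own weights `u_i²`; only the Euclidean
  -- norm of the remainder is controlled, so its weights are replaced by their maximum.
  calc ∑ i, (1 + u i ^ 2) * y i ^ 2
      ≤ ∑ i, (2 * c ^ 2 * (w i ^ 2 + u i ^ 2 * w i ^ 2)
          + 2 * (1 + ⨆ j, u j ^ 2) * (y i - c * w i) ^ 2) := by
        refine Finset.sum_le_sum fun i _ => ?_
        have h1 : y i ^ 2 ≤ 2 * c ^ 2 * w i ^ 2 + 2 * (y i - c * w i) ^ 2 := by
          nlinarith [sq_nonneg (y i - 2 * (c * w i))]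
        have h2 := mul_le_mul_of_nonneg_left h1 (by positivity : 0 ≤ 1 + u i ^ 2)
        have h3 := mul_le_mul_of_nonneg_right (sq_le_iSup_sq u i) (sq_nonneg (y i - c * w i))
        nlinarith
    _ = ∑ i, 2 * c ^ 2 * (w i ^ 2 + u i ^ 2 * w i ^ 2)
          + 2 * (1 + ⨆ j, u j ^ 2) * ∑ i, (y i - c * w i) ^ 2 := by
        rw [Finset.sum_add_distrib, ← Finset.mul_sum (f := fun i => (y i - c * w i) ^ 2)]
    _ ≤ ∑ i, 2 * c ^ 2 * (w i ^ 2 + u i ^ 2 * w i ^ 2)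
          + 2 * (1 + ⨆ j, u j ^ 2) * (δ ^ 2 * ∑ i, w i ^ 2) := by
        have := iSup_sq_nonneg u
        gcongr
    _ = _ := by
        rw [Finset.sum_add_distrib, Finset.mul_sum, Finset.mul_sum]
        congr 1
        exact Finset.sum_congr rfl fun i _ => by ring

theorem IsBase.integral_norm_reparamGrad_sub_sq_le (hφ : IsBase φ) (hs : Smooth l L) (hL : 0 < L)
    {c δ : ℝ} (hgrad : ∀ z z', ‖gradient l z - gradient l z' - c • (z - z')‖ ≤ δ * ‖z - z'‖)
    (lam lam' : Param d) :
    Integrable (fun u => ‖reparamGrad l lam u - reparamGrad l lam' u‖ ^ 2) (noise d φ) ∧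
    ∫ u, ‖reparamGrad l lam u - reparamGrad l lam' u‖ ^ 2 ∂(noise d φ)
      ≤ (2 * (1 + r4 φ) * c ^ 2 + 4 * δ ^ 2 * (1 / 2 + r4 φ + expMaxSq d φ))
        * ‖lam - lam'‖ ^ 2 := by
  have hcont : ∀ lam : Param d, Continuous fun u => reparamGrad l lam u := fun lam =>
    (continuous_reparamGrad hs hL).comp (by fun_prop : Continuous fun u : E d => (lam, u))
  set D := lam - lam' with hD
  have h1 : ∀ i, Integrable (fun u : E d => (D.snd i * u i + D.fst i) ^ 2) (noise d φ) :=
    fun i => hφ.integrable_affine_sq i _ _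
  have h2 : ∀ i, Integrable (fun u : E d => u i ^ 2 * (D.snd i * u i + D.fst i) ^ 2)
      (noise d φ) := fun i => hφ.integrable_sq_mul_affine_sq i _ _
  have h3 : ∀ i, Integrable (fun u : E d => (⨆ j, u j ^ 2) * (D.snd i * u i + D.fst i) ^ 2)
      (noise d φ) := fun i => hφ.integrable_iSup_sq_mul_affine_sq i _ _
  have h4 : ∀ i, Integrable (fun u : E d => 2 * c ^ 2 * ((D.snd i * u i + D.fst i) ^ 2
      + u i ^ 2 * (D.snd i * u i + D.fst i) ^ 2)) (noise d φ) :=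
    fun i => ((h1 i).add (h2 i)).const_mul _
  have h5 : ∀ i, Integrable (fun u : E d => 2 * δ ^ 2 * ((D.snd i * u i + D.fst i) ^ 2
      + (⨆ j, u j ^ 2) * (D.snd i * u i + D.fst i) ^ 2)) (noise d φ) :=
    fun i => ((h1 i).add (h3 i)).const_mul _
  have hbd := norm_reparamGrad_sub_sq_le hs.1 hgrad lam lam'
  simp only [← hD, reparam_apply] at hbd
  have hint := integrable_finsetSum Finset.univ fun i _ => (h4 i).fun_add (h5 i)
  have hint' : Integrable (fun u => ‖reparamGrad l lam u - reparamGrad l lam' u‖ ^ 2)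
      (noise d φ) :=
    hint.mono' (((hcont lam).sub (hcont lam')).norm.pow 2).aestronglyMeasurable
      (Eventually.of_forall fun u => by
        rw [Real.norm_of_nonneg (sq_nonneg _)]; exact hbd u)
  refine ⟨hint', (integral_mono hint' hint hbd).trans ?_⟩
  rw [integral_finsetSum _ fun i _ => (h4 i).fun_add (h5 i), norm_param_sq, Finset.mul_sum]
  refine Finset.sum_le_sum fun i _ => ?_
  rw [integral_add (h4 i) (h5 i), integral_const_mul, integral_const_mul,
    integral_add (h1 i) (h2 i), integral_add (h1 i) (h3 i), hφ.integral_affine_sq,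
    hφ.integral_sq_mul_affine_sq]
  have h6 := hφ.integral_iSup_sq_mul_affine_sq_le i (D.fst i) (D.snd i)
  have h7 := mul_le_mul_of_nonneg_left h6 (by positivity : 0 ≤ 2 * δ ^ 2)
  -- The diagonal part integrates to `2c²(2a² + (1 + r₄)b²)` with `a = D.fst i`, `b = D.snd i`; `r₄
  -- ≥ 1` puts `1 + r₄` in front of both squares.
  have h8 : 0 ≤ c ^ 2 * (r4 φ - 1) * D.fst i ^ 2 :=
    mul_nonneg (mul_nonneg (sq_nonneg _) (by linarith [hφ.one_le_r4])) (sq_nonneg _)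
  nlinarith

end Reparam

/-! ### The expected objective -/

/-- The gradient `∇f(λ) = 𝔼 ∇_λ ℓ(T_λ(u))`. -/
def meanGrad {d : ℕ} (l : E d → ℝ) (φ : Measure ℝ) (lam : Param d) : Param d :=
  ∫ u, reparamGrad l lam u ∂(noise d φ)

/-- Mean square Lipschitz continuity, with constant `A`, of the reparametrization gradient on the
whole parameter space. -/
def MeanSquareLipschitz {d : ℕ} (l : E d → ℝ) (φ : Measure ℝ) (A : ℝ) : Prop :=
  ∀ lam lam' : Param d,
    Integrable (fun u => ‖reparamGrad l lam u - reparamGrad l lam' u‖ ^ 2) (noise d φ) ∧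
    ∫ u, ‖reparamGrad l lam u - reparamGrad l lam' u‖ ^ 2 ∂(noise d φ) ≤ A * ‖lam - lam'‖ ^ 2

section Objective

variable {d : ℕ} {l : E d → ℝ} {φ : Measure ℝ} {μ L A : ℝ} {z : E d}

theorem continuous_reparamGrad_noise (hs : Smooth l L) (hL : 0 < L) (lam : Param d) :
    Continuous fun u => reparamGrad l lam u :=
  (continuous_reparamGrad hs hL).comp (by fun_prop : Continuous fun u : E d => (lam, u))

theorem continuous_reparam_noise (lam : Param d) : Continuous (reparam lam) :=
  continuous_reparam.comp (by fun_prop : Continuous fun u : E d => (lam, u))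

theorem norm_sub_center_sq (lam : Param d) (z : E d) :
    ‖lam - WithLp.toLp 2 (z, 0)‖ ^ 2 = sigmaSq lam z := by
  rw [WithLp.prod_norm_sq_eq_of_L2, sigmaSq]
  simp

theorem reparam_center (z u : E d) : reparam (WithLp.toLp 2 (z, 0)) u = z := by
  ext i
  simp

theorem reparamGrad_center (hl : Differentiable ℝ l) (hz : gradient l z = 0) (u : E d) :
    reparamGrad l (WithLp.toLp 2 (z, 0)) u = 0 := by
  have h0 : (WithLp.toLp 2 fun i => u i * (0 : E d) i : E d) = 0 := by ext i; simp
  rw [reparamGrad_eq hl, reparam_center, hz, h0]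
  rfl

/-- Compare with `(z, 0)`, where `T_λ(u) = z` for every `u` and the gradient is identically zero.
This parameter lies outside `Λ`, which is why the Lipschitz bound is required on the whole space. -/
theorem MeanSquareLipschitz.second_moment (hA : MeanSquareLipschitz l φ A)
    (hl : Differentiable ℝ l) (hz : gradient l z = 0) (lam : Param d) :
    Integrable (fun u => ‖reparamGrad l lam u‖ ^ 2) (noise d φ) ∧
    ∫ u, ‖reparamGrad l lam u‖ ^ 2 ∂(noise d φ) ≤ A * sigmaSq lam z := by
  have := hA lam (WithLp.toLp 2 (z, 0))
  simpa only [reparamGrad_center hl hz, sub_zero, norm_sub_center_sq] using this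

theorem integrable_of_integrable_norm_sq {Ω X : Type*} [MeasurableSpace Ω] {P : Measure Ω}
    [IsFiniteMeasure P] [NormedAddCommGroup X] {Y : Ω → X} (hY : AEStronglyMeasurable Y P)
    (h2 : Integrable (fun ω => ‖Y ω‖ ^ 2) P) : Integrable Y P :=
  ((memLp_two_iff_integrable_sq_norm hY).2 h2).integrable one_le_two

theorem MeanSquareLipschitz.integrable_reparamGrad (hA : MeanSquareLipschitz l φ A)
    (hφ : IsBase φ) (hs : Smooth l L) (hL : 0 < L) (hz : gradient l z = 0) (lam : Param d) :
    Integrable (fun u => reparamGrad l lam u) (noise d φ) := by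
  have := hφ.isProbabilityMeasure_noise d
  exact integrable_of_integrable_norm_sq
    (continuous_reparamGrad_noise hs hL lam).aestronglyMeasurable
    (hA.second_moment hs.1 hz lam).1

theorem f_eq (hl : Continuous l) (lam : Param d) :
    f l φ lam = ∫ u, l (reparam lam u) ∂(noise d φ) := by
  rw [f, q, integral_map (continuous_reparam_noise lam).measurable.aemeasurable
    hl.aestronglyMeasurable]

theorem IsBase.integrable_target (hφ : IsBase φ)
    (hq : HasQuadraticBounds l (gradient l) μ (2 * L)) (hμ : 0 < μ)
    (hz : gradient l z = 0) (lam : Param d) :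
    Integrable (fun u => l (reparam lam u)) (noise d φ) := by
  have := hφ.isProbabilityMeasure_noise d
  have h1 := (hφ.integrable_norm_reparam_sq (lam - WithLp.toLp 2 (z, 0))).const_mul L
  refine ((integrable_const |l z|).add h1).mono'
    (hq.continuous.comp (continuous_reparam_noise lam)).aestronglyMeasurable
    (Eventually.of_forall fun u => ?_)
  rw [Pi.add_apply, ← reparam_sub, reparam_center, Real.norm_eq_abs, abs_le]
  have h2 := hq.upper z (reparam lam u)
  have h3 := hq.lower z (reparam lam u)
  rw [hz, inner_zero_left] at h2 h3
  have h4 : 0 ≤ μ / 2 * ‖reparam lam u - z‖ ^ 2 := by positivity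
  constructor <;> linarith [neg_abs_le (l z), le_abs_self (l z)]

/-- The expected objective inherits the quadratic bounds of the target. -/
theorem MeanSquareLipschitz.hasQuadraticBounds_f (hA : MeanSquareLipschitz l φ A)
    (hφ : IsBase φ) (hs : Smooth l L) (hL : 0 < L) (hμ : 0 < μ) (hz : gradient l z = 0)
    (hq : HasQuadraticBounds l (gradient l) μ (2 * L)) :
    HasQuadraticBounds (f l φ) (meanGrad l φ) μ (2 * L) := by
  have hlint := hφ.integrable_target hq hμ hz
  have hgint := hA.integrable_reparamGrad hφ hs hL hz
  have hinner : ∀ x v : Param d,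
      Integrable (fun u => inner ℝ (reparamGrad l x u) v) (noise d φ) ∧
      ∫ u, inner ℝ (reparamGrad l x u) v ∂(noise d φ) = inner ℝ (meanGrad l φ x) v := by
    intro x v
    refine ⟨(hgint x).inner_const v, ?_⟩
    rw [meanGrad, real_inner_comm, ← integral_inner (hgint x)]
    simp only [real_inner_comm]
  have hsum : ∀ (x y : Param d) (c : ℝ),
      Integrable (fun u => l (reparam x u) + inner ℝ (reparamGrad l x u) (y - x)
        + c * ‖reparam (y - x) u‖ ^ 2) (noise d φ) ∧
      ∫ u, (l (reparam x u) + inner ℝ (reparamGrad l x u) (y - x)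
        + c * ‖reparam (y - x) u‖ ^ 2) ∂(noise d φ)
      = f l φ x + inner ℝ (meanGrad l φ x) (y - x) + c * ‖y - x‖ ^ 2 := by
    intro x y c
    have h1 := (hlint x).fun_add (hinner x (y - x)).1
    have h2 := (hφ.integrable_norm_reparam_sq (y - x)).const_mul c
    refine ⟨h1.add h2, ?_⟩
    rw [integral_add h1 h2, integral_add (hlint x) (hinner x (y - x)).1, (hinner x (y - x)).2,
      integral_const_mul, hφ.integral_norm_reparam_sq, f_eq hq.continuous]
  -- Both bounds are those of `ℓ` between `T_x(u)` and `T_y(u)`, integrated over the noise;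
  -- adjointness and the isometry identify the terms.
  constructor
  · intro x y
    rw [← (hsum x y _).2, f_eq hq.continuous]
    refine integral_mono (hsum x y _).1 (hlint y) fun u => ?_
    have := hq.lower (reparam x u) (reparam y u)
    rwa [reparam_sub, ← inner_reparamGrad hs.1] at this
  · intro x y
    rw [← (hsum x y _).2, f_eq hq.continuous]
    refine integral_mono (hlint y) (hsum x y _).1 fun u => ?_
    have := hq.upper (reparam x u) (reparam y u)
    rwa [reparam_sub, ← inner_reparamGrad hs.1] at this

/-! ### One step of stochastic proximal gradient descent -/

/-- The expected squared distance to a stationary point after one stochastic gradient step. -/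
theorem MeanSquareLipschitz.integral_step_le (hA : MeanSquareLipschitz l φ A)
    (hφ : IsBase φ) (hs : Smooth l L) (hL : 0 < L) (hμ : 0 < μ) (hz : gradient l z = 0)
    (hq : HasQuadraticBounds l (gradient l) μ (2 * L)) {γ : ℝ} (hγ : 0 < γ)
    (hγA : 2 * γ * A ≤ μ) (lam p : Param d) :
    Integrable (fun u => ‖lam - γ • reparamGrad l lam u - (p - γ • meanGrad l φ p)‖ ^ 2)
      (noise d φ) ∧
    ∫ u, ‖lam - γ • reparamGrad l lam u - (p - γ • meanGrad l φ p)‖ ^ 2 ∂(noise d φ)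
      ≤ (1 - γ * μ) * ‖lam - p‖ ^ 2 + 2 * γ ^ 2 * (A * sigmaSq p z) := by
  have := hφ.isProbabilityMeasure_noise d
  have hf := hA.hasQuadraticBounds_f hφ hs hL hμ hz hq
  have hgint := hA.integrable_reparamGrad hφ hs hL hz
  have hcont := continuous_reparamGrad_noise hs hL (l := l)
  set v := meanGrad l φ p with hv
  have hI : Integrable (fun u => inner ℝ (lam - p) (reparamGrad l lam u)) (noise d φ) :=
    (hgint lam).const_inner _
  have hI' : Integrable (fun u => inner ℝ v (reparamGrad l p u)) (noise d φ) :=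
    (hgint p).const_inner _
  have hIval : ∫ u, inner ℝ (lam - p) (reparamGrad l lam u) ∂(noise d φ)
      = inner ℝ (lam - p) (meanGrad l φ lam) := integral_inner (hgint lam) _
  have hIval' : ∫ u, inner ℝ v (reparamGrad l p u) ∂(noise d φ) = ‖v‖ ^ 2 := by
    rw [integral_inner (hgint p), ← real_inner_self_eq_norm_sq, hv, meanGrad]
  obtain ⟨hL1, hL2⟩ := hA lam p
  obtain ⟨hV1, hV2⟩ := hA.second_moment hs.1 hz p
  -- The deviation of the stochastic gradient from `v` is split at the gradient at `p` with the same
  -- noise: a Lipschitz part proportional to the current error and the variance at `p`.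
  set B : E d → ℝ := fun u => ‖lam - p‖ ^ 2
    - 2 * γ * (inner ℝ (lam - p) (reparamGrad l lam u) - inner ℝ (lam - p) v)
    + 2 * γ ^ 2 * ‖reparamGrad l lam u - reparamGrad l p u‖ ^ 2
    + 2 * γ ^ 2 * (‖reparamGrad l p u‖ ^ 2 - 2 * inner ℝ v (reparamGrad l p u) + ‖v‖ ^ 2) with hB
  have hle : ∀ u, ‖lam - γ • reparamGrad l lam u - (p - γ • v)‖ ^ 2 ≤ B u := by
    intro u
    have e1 : lam - γ • reparamGrad l lam u - (p - γ • v)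
        = (lam - p) - γ • (reparamGrad l lam u - v) := by module
    have e2 : reparamGrad l lam u - v
        = (reparamGrad l lam u - reparamGrad l p u) + (reparamGrad l p u - v) := by abel
    have h1 : ‖reparamGrad l lam u - v‖ ^ 2 ≤ 2 * ‖reparamGrad l lam u - reparamGrad l p u‖ ^ 2
        + 2 * ‖reparamGrad l p u - v‖ ^ 2 := by
      have h2 := norm_add_le (reparamGrad l lam u - reparamGrad l p u) (reparamGrad l p u - v)
      rw [← e2] at h2
      nlinarith [norm_nonneg (reparamGrad l lam u - v),
        sq_nonneg (‖reparamGrad l lam u - reparamGrad l p u‖ - ‖reparamGrad l p u - v‖)]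
    have h3 := mul_le_mul_of_nonneg_left h1 (sq_nonneg γ)
    rw [e1, norm_sub_sq_real (lam - p), inner_smul_right, norm_smul, mul_pow, Real.norm_eq_abs,
      sq_abs, inner_sub_right]
    rw [norm_sub_sq_real (reparamGrad l p u) v, real_inner_comm] at h3
    simp only [hB]
    linarith
  have i1 : Integrable (fun u => ‖lam - p‖ ^ 2
      - 2 * γ * (inner ℝ (lam - p) (reparamGrad l lam u) - inner ℝ (lam - p) v)) (noise d φ) :=
    (integrable_const _).sub ((hI.sub (integrable_const _)).const_mul _)
  have i2 : Integrable (fun u => 2 * γ ^ 2 * ‖reparamGrad l lam u - reparamGrad l p u‖ ^ 2)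
      (noise d φ) := hL1.const_mul _
  have i3 : Integrable (fun u => 2 * γ ^ 2 * (‖reparamGrad l p u‖ ^ 2
      - 2 * inner ℝ v (reparamGrad l p u) + ‖v‖ ^ 2)) (noise d φ) :=
    ((hV1.sub (hI'.const_mul 2)).add (integrable_const _)).const_mul _
  have hBint : Integrable B (noise d φ) := (i1.add i2).add i3
  have hint : Integrable (fun u => ‖lam - γ • reparamGrad l lam u - (p - γ • v)‖ ^ 2)
      (noise d φ) := by
    refine hBint.mono' ?_ (Eventually.of_forall fun u => ?_)
    · have := hcont lam
      exact (by fun_prop : Continuous fun u =>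
        ‖lam - γ • reparamGrad l lam u - (p - γ • v)‖ ^ 2).aestronglyMeasurable
    · rw [Real.norm_of_nonneg (sq_nonneg _)]
      exact hle u
  refine ⟨hint, (integral_mono hint hBint hle).trans ?_⟩
  have hBval : ∫ u, B u ∂(noise d φ) = ‖lam - p‖ ^ 2
      - 2 * γ * (inner ℝ (lam - p) (meanGrad l φ lam) - inner ℝ (lam - p) v)
      + 2 * γ ^ 2 * ∫ u, ‖reparamGrad l lam u - reparamGrad l p u‖ ^ 2 ∂(noise d φ)
      + 2 * γ ^ 2 * (∫ u, ‖reparamGrad l p u‖ ^ 2 ∂(noise d φ) - 2 * ‖v‖ ^ 2 + ‖v‖ ^ 2) := by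
    have j1 : Integrable (fun u => inner ℝ (lam - p) (reparamGrad l lam u) - inner ℝ (lam - p) v)
        (noise d φ) := hI.sub (integrable_const _)
    have j2 : Integrable (fun u => ‖reparamGrad l p u‖ ^ 2 - 2 * inner ℝ v (reparamGrad l p u))
        (noise d φ) := hV1.sub (hI'.const_mul 2)
    simp only [hB]
    rw [integral_add (i1.fun_add i2) i3, integral_add i1 i2,
      integral_sub (integrable_const _) (j1.const_mul _),
      integral_const_mul, integral_const_mul, integral_const_mul,
      integral_sub hI (integrable_const _),
      integral_add j2 (integrable_const _),
      integral_sub hV1 (hI'.const_mul 2), integral_const_mul, hIval, hIval']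
    simp
  rw [hBval]
  have hmono := hf.strongly_monotone lam p
  rw [← hv, inner_sub_left, real_inner_comm, real_inner_comm (lam - p) v] at hmono
  have k1 := mul_le_mul_of_nonneg_left hmono hγ.le
  have k2 := mul_le_mul_of_nonneg_left hL2 (by positivity : 0 ≤ 2 * γ ^ 2)
  have k3 := mul_le_mul_of_nonneg_left hV2 (by positivity : 0 ≤ 2 * γ ^ 2)
  -- Strong monotonicity contracts by `1 - 2γμ`; since `2γA ≤ μ`, the Lipschitz part `2γ²A` costs at
  -- most `γμ` of this.
  have k4 := mul_le_mul_of_nonneg_left hγA (by positivity : 0 ≤ γ * ‖lam - p‖ ^ 2)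
  have k5 : 0 ≤ γ ^ 2 * ‖v‖ ^ 2 := by positivity
  linarith

end Objective

/-! ### The iterates -/

section Iterates

variable {d : ℕ} {l : E d → ℝ} {h : Param d → EReal} {φ : Measure ℝ} {μ L A : ℝ} {z : E d}
  {γ : ℕ → ℝ} {lam0 : Param d}

theorem spgd_congr {u u' : ℕ → E d} {t : ℕ} (huu' : ∀ s < t, u s = u' s) :
    spgd l h γ lam0 u t = spgd l h γ lam0 u' t := by
  induction t with
  | zero => rfl
  | succ t ih =>
    simp only [spgd, ih fun s hs => huu' s (hs.trans t.lt_succ_self), huu' t t.lt_succ_self]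

theorem measurable_spgd (hs : Smooth l L) (hL : 0 < L) (hh : IsRegularizer h)
    (hγ : ∀ t, 0 < γ t) (t : ℕ) : Measurable fun u => spgd l h γ lam0 u t := by
  induction t with
  | zero => exact measurable_const
  | succ t ih =>
    simp only [spgd]
    have hg : Measurable fun u : ℕ → E d => reparamGrad l (spgd l h γ lam0 u t) (u t) :=
      (continuous_reparamGrad hs hL).measurable.comp (ih.prodMk (measurable_pi_apply t))
    exact (hh.continuous_prox (hγ t)).measurable.comp (ih.sub (hg.fun_const_smul _))

theorem indepFun_spgd {Ω : Type*} [MeasurableSpace Ω] {P : Measure Ω}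
    (hs : Smooth l L) (hL : 0 < L) (hh : IsRegularizer h) (hγ : ∀ t, 0 < γ t)
    {u : ℕ → Ω → E d} (hu : ∀ t, Measurable (u t)) (hind : iIndepFun u P) (t : ℕ) :
    IndepFun (fun ω => spgd l h γ lam0 (fun t => u t ω) t) (u t) P := by
  have h1 := hind.indepFun_finset (Finset.range t) {t} (by simp) hu
  -- The iterate at time `t` uses only the noise before `t`, so padding the rest with `0` exhibits
  -- it as a function of finitely many variables independent of `u t`.
  have hmeas : Measurable fun w : Finset.range t → E d =>
      spgd l h γ lam0 (fun s => if hs : s ∈ Finset.range t then w ⟨s, hs⟩ else 0) t := by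
    refine (measurable_spgd hs hL hh hγ t).comp (measurable_pi_lambda _ fun s => ?_)
    by_cases hst : s ∈ Finset.range t
    · simp only [hst, dite_true]
      exact measurable_pi_apply _
    · simp only [hst, dite_false]
      exact measurable_const
  have h2 := h1.comp hmeas
    (measurable_pi_apply (⟨t, by simp⟩ : ({t} : Finset ℕ)))
  have e : (fun ω => spgd l h γ lam0 (fun t => u t ω) t) = fun ω => spgd l h γ lam0
      (fun s => if _ : s ∈ Finset.range t then u s ω else 0) t := by
    ext1 ω
    exact spgd_congr fun s hst => by simp [hst]
  rw [e]
  exact h2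

/-- The mean squared distance to the solution is controlled by any sequence that satisfies the
one-step recursion. -/
theorem lintegral_spgd_le (hA : MeanSquareLipschitz l φ A)
    (hφ : IsBase φ) (hs : Smooth l L) (hL : 0 < L) (hμ : 0 < μ) (hz : gradient l z = 0)
    (hq : HasQuadraticBounds l (gradient l) μ (2 * L)) (hh : IsRegularizer h)
    (hγ : ∀ t, 0 < γ t) (hγA : ∀ t, 2 * γ t * A ≤ μ) (hγμ : ∀ t, γ t * μ ≤ 1) (hA0 : 0 ≤ A)
    {p : Param d} (hp : IsSubgradient h p (-meanGrad l φ p)) {r : ℕ → ℝ}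
    (hr0 : ‖lam0 - p‖ ^ 2 ≤ r 0)
    (hr : ∀ t, (1 - γ t * μ) * r t + 2 * γ t ^ 2 * (A * sigmaSq p z) ≤ r (t + 1))
    {Ω : Type*} [MeasurableSpace Ω] {P : Measure Ω} [IsProbabilityMeasure P]
    {u : ℕ → Ω → E d} (hu : ∀ t, Measurable (u t)) (hind : iIndepFun u P)
    (hlaw : ∀ t, P.map (u t) = noise d φ) (t : ℕ) :
    ∫⁻ ω, ENNReal.ofReal (‖spgd l h γ lam0 (fun t => u t ω) t - p‖ ^ 2) ∂P
      ≤ ENNReal.ofReal (r t) := by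
  have := hφ.isProbabilityMeasure_noise d
  have hnoise : ∀ t, 0 ≤ 2 * γ t ^ 2 * (A * sigmaSq p z) := fun t => by
    have : 0 ≤ sigmaSq p z := by unfold sigmaSq; positivity
    positivity
  have hcontr : ∀ t, 0 ≤ 1 - γ t * μ := fun t => by linarith [hγμ t]
  have hrnonneg : ∀ t, 0 ≤ r t := by
    intro t
    induction t with
    | zero => exact (sq_nonneg _).trans hr0
    | succ t ih => exact (add_nonneg (mul_nonneg (hcontr t) ih) (hnoise t)).trans (hr t)
  -- Lower Lebesgue integrals let Tonelli apply without first knowing that the squared errors are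
  -- integrable.
  induction t with
  | zero =>
    simp only [spgd, lintegral_const, measure_univ, mul_one]
    exact ENNReal.ofReal_le_ofReal hr0
  | succ t ih =>
    set S : Ω → Param d := fun ω => spgd l h γ lam0 (fun t => u t ω) t with hS
    have hSm : Measurable S :=
      (measurable_spgd hs hL hh hγ t).comp (measurable_pi_lambda _ fun t => hu t)
    set Φ : Param d × E d → ℝ := fun x =>
      ‖x.1 - γ t • reparamGrad l x.1 x.2 - (p - γ t • meanGrad l φ p)‖ ^ 2 with hΦ
    have hΦm : Measurable Φ := by
      have := continuous_reparamGrad hs hL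
      exact (by fun_prop : Continuous Φ).measurable
    have hnoise := hnoise t
    have hcontr := hcontr t
    -- Independence makes the joint law a product, so the one-step estimate applies with the current
    -- iterate frozen.
    have hmap : P.map (fun ω => (S ω, u t ω)) = (P.map S).prod (noise d φ) := by
      rw [← hlaw t]
      exact (indepFun_spgd hs hL hh hγ hu hind t).map_prod_eq_prod_map_map
        hSm.aemeasurable (hu t).aemeasurable
    calc ∫⁻ ω, ENNReal.ofReal (‖spgd l h γ lam0 (fun t => u t ω) (t + 1) - p‖ ^ 2) ∂P
        ≤ ∫⁻ ω, ENNReal.ofReal (Φ (S ω, u t ω)) ∂P := by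
          refine lintegral_mono fun ω => ENNReal.ofReal_le_ofReal ?_
          exact pow_le_pow_left₀ (norm_nonneg _)
            (hh.norm_prox_sub_le_of_isSubgradient (hγ t) hp _) 2
      _ = ∫⁻ x, ENNReal.ofReal (Φ x) ∂((P.map S).prod (noise d φ)) := by
          rw [← hmap, lintegral_map hΦm.ennreal_ofReal (hSm.prodMk (hu t))]
      _ = ∫⁻ lam, ∫⁻ x, ENNReal.ofReal (Φ (lam, x)) ∂(noise d φ) ∂(P.map S) :=
          lintegral_prod _ hΦm.ennreal_ofReal.aemeasurable
      _ ≤ ∫⁻ lam, (ENNReal.ofReal (1 - γ t * μ) * ENNReal.ofReal (‖lam - p‖ ^ 2)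
            + ENNReal.ofReal (2 * γ t ^ 2 * (A * sigmaSq p z))) ∂(P.map S) := by
          refine lintegral_mono fun lam => ?_
          obtain ⟨h1, h2⟩ := hA.integral_step_le hφ hs hL hμ hz hq (hγ t) (hγA t) lam p
          rw [← ofReal_integral_eq_lintegral_ofReal h1
            (Eventually.of_forall fun x => sq_nonneg _), ← ENNReal.ofReal_mul hcontr,
            ← ENNReal.ofReal_add (mul_nonneg hcontr (sq_nonneg _)) hnoise]
          exact ENNReal.ofReal_le_ofReal h2
      _ = ENNReal.ofReal (1 - γ t * μ) * ∫⁻ ω, ENNReal.ofReal (‖S ω - p‖ ^ 2) ∂P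
            + ENNReal.ofReal (2 * γ t ^ 2 * (A * sigmaSq p z)) := by
          rw [lintegral_map (by fun_prop) hSm, lintegral_add_right _ measurable_const,
            lintegral_const_mul _ (by fun_prop)]
          simp
      _ ≤ ENNReal.ofReal (1 - γ t * μ) * ENNReal.ofReal (r t)
            + ENNReal.ofReal (2 * γ t ^ 2 * (A * sigmaSq p z)) := by gcongr
      _ ≤ ENNReal.ofReal (r (t + 1)) := by
          rw [← ENNReal.ofReal_mul hcontr,
            ← ENNReal.ofReal_add (mul_nonneg hcontr (hrnonneg t)) hnoise]
          exact ENNReal.ofReal_le_ofReal (hr t)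

end Iterates

/-! ### The scalar recursion of the two-stage schedule -/

section Recursion

/-- The error bounds produced by the one-step recursion under the step sizes `γ`, where
`G = 𝓛² / μ²` and `s = σ_*²`. -/
def errorBound (μ G s D : ℝ) (γ : ℕ → ℝ) : ℕ → ℝ
  | 0 => D
  | t + 1 => (1 - γ t * μ) * errorBound μ G s D γ t + 2 * γ t ^ 2 * (μ ^ 2 * G * s)

/-- The switching time of the two-stage schedule. -/
def switchTime (G s D : ℝ) : ℕ := ⌈4 * G + 2 * G * Real.posLog (D / s)⌉₊

variable {μ G s D : ℝ}

theorem exp_neg_mul_le_of_posLog_le {x D s : ℝ} (hD : 0 ≤ D) (hs : 0 < s)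
    (hx : Real.posLog (D / s) ≤ x) : Real.exp (-x) * D ≤ s := by
  rcases hD.eq_or_lt with rfl | hD
  · simpa using hs.le
  have h1 : D / s ≤ Real.exp x := by
    rw [← Real.log_le_iff_le_exp (by positivity)]
    exact (le_max_right _ _).trans hx
  rw [Real.exp_neg, inv_mul_le_iff₀ (Real.exp_pos x)]
  rwa [div_le_iff₀ hs] at h1

/-- With this constant step the recursion is `r ↦ (1 - 1/(2G)) r + s/(2G)`, whose fixed point is
`s`. The range ends at `tstar + 1` because the step with index `tstar` produces that iterate. -/
theorem errorBound_le_first_stage (hμ : 0 < μ) (hG : 1 ≤ G) (hs : 0 < s) (hD : 0 ≤ D)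
    {tstar t : ℕ} (ht : t ≤ tstar + 1) :
    errorBound μ G s D (stepSize μ (1 / (2 * μ * G)) tstar) t
      ≤ Real.exp (-(t / (2 * G))) * D + s := by
  have hG0 : 0 < G := by linarith
  induction t with
  | zero => simp [errorBound, hs.le]
  | succ t ih =>
    have ht' : t ≤ tstar := by omega
    rw [errorBound, stepSize, if_pos ht']
    have e1 : 1 - 1 / (2 * μ * G) * μ = 1 - 1 / (2 * G) := by field_simp
    have e2 : 2 * (1 / (2 * μ * G)) ^ 2 * (μ ^ 2 * G * s) = 1 / (2 * G) * s := by
      field_simp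
    have h0 : 0 ≤ 1 - 1 / (2 * G) := by
      rw [sub_nonneg, div_le_one (by positivity)]
      linarith
    have h1 : 1 - 1 / (2 * G) ≤ Real.exp (-(1 / (2 * G))) := by
      linarith [Real.add_one_le_exp (-(1 / (2 * G)))]
    rw [e1, e2]
    calc (1 - 1 / (2 * G)) * errorBound μ G s D (stepSize μ (1 / (2 * μ * G)) tstar) t
          + 1 / (2 * G) * s
        ≤ (1 - 1 / (2 * G)) * (Real.exp (-(t / (2 * G))) * D + s) + 1 / (2 * G) * s := by
          gcongr
          exact ih (by omega)
      _ = (1 - 1 / (2 * G)) * (Real.exp (-(t / (2 * G))) * D) + s := by ring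
      _ ≤ Real.exp (-(1 / (2 * G))) * (Real.exp (-(t / (2 * G))) * D) + s := by
          gcongr
      _ = Real.exp (-((t + 1 : ℕ) / (2 * G))) * D + s := by
          rw [← mul_assoc, ← Real.exp_add]
          congr 3
          push_cast
          ring

/-- The steps satisfy `1 - γ_t μ = t²/(t+1)²`, so the recursion multiplied by `(t+1)²` telescopes
and each noise term contributes at most `8Gs`. -/
theorem errorBound_le_second_stage (hμ : 0 < μ) (hG : 0 ≤ G) (hs : 0 ≤ s) {γ0 : ℝ}
    {tstar t : ℕ} (ht : tstar + 1 ≤ t) :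
    (t : ℝ) ^ 2 * errorBound μ G s D (stepSize μ γ0 tstar) t
      ≤ ((tstar + 1 : ℕ) : ℝ) ^ 2 * errorBound μ G s D (stepSize μ γ0 tstar) (tstar + 1)
        + 8 * G * s * t := by
  induction t, ht using Nat.le_induction with
  | base =>
    have : 0 ≤ 8 * G * s * ((tstar + 1 : ℕ) : ℝ) := by positivity
    linarith
  | succ t ht ih =>
    rw [errorBound]
    set r := errorBound μ G s D (stepSize μ γ0 tstar) t with hr
    rw [stepSize, if_neg (by omega)]
    have ht0 : (0 : ℝ) < (t : ℝ) + 1 := by positivity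
    have e : ((t + 1 : ℕ) : ℝ) ^ 2 * ((1 - 1 / μ * ((2 * t + 1) / ((t : ℝ) + 1) ^ 2) * μ) * r
        + 2 * (1 / μ * ((2 * t + 1) / ((t : ℝ) + 1) ^ 2)) ^ 2 * (μ ^ 2 * G * s))
        = (t : ℝ) ^ 2 * r + 2 * ((2 * t + 1) / ((t : ℝ) + 1)) ^ 2 * (G * s) := by
      push_cast
      field_simp
      ring
    rw [e]
    have h1 : (2 * t + 1) / ((t : ℝ) + 1) ≤ 2 := by
      rw [div_le_iff₀ ht0]
      linarith
    have h2 : ((2 * t + 1) / ((t : ℝ) + 1)) ^ 2 ≤ 4 := by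
      have := pow_le_pow_left₀ (by positivity) h1 2
      linarith
    have h3 := mul_le_mul_of_nonneg_right h2 (mul_nonneg hG hs)
    push_cast at ih ⊢
    linarith

theorem stepSize_switchTime (hμ : 0 < μ) (hG : 1 ≤ G) (t : ℕ) :
    0 < stepSize μ (1 / (2 * μ * G)) (switchTime G s D) t ∧
    stepSize μ (1 / (2 * μ * G)) (switchTime G s D) t ≤ 1 / (2 * μ * G) := by
  have hG0 : 0 < G := by linarith
  rw [stepSize]
  split_ifs with ht
  · exact ⟨by positivity, le_rfl⟩
  · refine ⟨by positivity, ?_⟩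
    -- The summand `4 * G` of the switching time ensures that the decreasing steps never exceed the
    -- constant one.
    have h1 : 4 * G ≤ t := by
      have h2 : (switchTime G s D : ℝ) ≤ t := by exact_mod_cast (not_le.1 ht).le
      have h3 : 4 * G + 2 * G * Real.posLog (D / s) ≤ switchTime G s D := Nat.le_ceil _
      have h4 : 0 ≤ 2 * G * Real.posLog (D / s) :=
        mul_nonneg (by positivity) Real.posLog_nonneg
      linarith
    have ht0 : (0 : ℝ) < (t : ℝ) + 1 := by positivity
    rw [div_mul_div_comm, div_le_div_iff₀ (by positivity) (by positivity)]
    have : (2 * (t : ℝ) + 1) * (2 * G) ≤ ((t : ℝ) + 1) ^ 2 := by nlinarith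
    nlinarith

/-- Iteration complexity of the two-stage schedule. -/
theorem errorBound_le_of_le (hμ : 0 < μ) (hG : 1 ≤ G) (hs : 0 < s) (hD : 0 ≤ D) {ε : ℝ}
    (hε : 0 < ε) {T : ℕ}
    (hT : 16 * (G * (s / ε + √s * Real.posLog (D / s) / √ε + Real.posLog (D / ε) + 1)) ≤ T) :
    errorBound μ G s D (stepSize μ (1 / (2 * μ * G)) (switchTime G s D)) T ≤ ε := by
  have hG0 : 0 < G := by linarith
  set P := Real.posLog (D / s) with hP
  set Q := Real.posLog (D / ε) with hQ
  have hP0 : 0 ≤ P := Real.posLog_nonneg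
  have hQ0 : 0 ≤ Q := Real.posLog_nonneg
  set τ := switchTime G s D with hτ
  -- In terms of `a = √(s/ε)` the complexity is `G (a² + aP + Q + 1)`.
  set a := √s / √ε with ha
  have ha0 : 0 ≤ a := by positivity
  have ha2 : a ^ 2 = s / ε := by
    rw [ha, div_pow, Real.sq_sqrt hs.le, Real.sq_sqrt hε.le]
  have hsa : s = a ^ 2 * ε := by rw [ha2]; field_simp
  have hT' : 16 * (G * (a ^ 2 + a * P + Q + 1)) ≤ T := by
    have e : √s * P / √ε = a * P := by rw [ha]; ring
    rwa [ha2, ← e]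
  have hτlow : 2 * G * P ≤ (τ + 1 : ℕ) := by
    have h3 : 4 * G + 2 * G * P ≤ τ := Nat.le_ceil _
    push_cast
    linarith
  have hτup : ((τ + 1 : ℕ) : ℝ) ≤ 6 * G + 2 * G * P := by
    -- Rounding up and the extra step add at most `2`, absorbed into `2 * G` because `1 ≤ G`.
    have h3 : (τ : ℝ) < 4 * G + 2 * G * P + 1 := Nat.ceil_lt_add_one (by positivity)
    push_cast
    linarith
  have hGa : 0 ≤ G * a ^ 2 := by positivity
  have hGP : 0 ≤ G * P := by positivity
  have hGaP : 0 ≤ G * (a * P) := by positivity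
  have hGQ : 0 ≤ G * Q := by positivity
  rcases le_total (τ + 1) T with hTτ | hTτ
  · have h1 := errorBound_le_second_stage (D := D) hμ hG0.le hs.le (γ0 := 1 / (2 * μ * G)) hTτ
    have h2 := errorBound_le_first_stage hμ hG hs hD (le_refl (τ + 1))
    have h3 : Real.exp (-((τ + 1 : ℕ) / (2 * G))) * D ≤ s := by
      refine exp_neg_mul_le_of_posLog_le hD hs ?_
      rw [le_div_iff₀ (by positivity)]
      linarith
    have hT0 : (0 : ℝ) < T := by
      have : 0 < τ + 1 := Nat.succ_pos _
      exact_mod_cast this.trans_le hTτ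
    set r := errorBound μ G s D (stepSize μ (1 / (2 * μ * G)) τ) T with hr
    have h4 : (T : ℝ) ^ 2 * r ≤ ((τ + 1 : ℕ) : ℝ) ^ 2 * (2 * s) + 8 * G * s * T := by
      refine h1.trans ?_
      gcongr
      linarith
    -- The error `2s` left by the first stage is damped by `((τ+1)/T)²`; this bound leaves at most
    -- `ε / 2` of it.
    have h5 : ((τ + 1 : ℕ) : ℝ) * a ≤ T / 2 := by
      have h6 := mul_le_mul_of_nonneg_right hτup ha0
      have h7 : G * a ≤ G * ((a ^ 2 + 1) / 2) := by
        gcongr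
        nlinarith [sq_nonneg (a - 1)]
      nlinarith
    have h8 : ((τ + 1 : ℕ) : ℝ) ^ 2 * a ^ 2 ≤ T ^ 2 / 4 := by
      have := pow_le_pow_left₀ (by positivity) h5 2
      rw [mul_pow] at this
      linarith
    have h9 : 16 * (G * a ^ 2) ≤ T := by nlinarith
    have h10 := mul_le_mul_of_nonneg_right h9 hT0.le
    have h11 : (T : ℝ) ^ 2 * r ≤ T ^ 2 * ε := by
      have h12 : ((τ + 1 : ℕ) : ℝ) ^ 2 * (2 * s) + 8 * G * s * T
          = (2 * (((τ + 1 : ℕ) : ℝ) ^ 2 * a ^ 2) + 8 * (G * a ^ 2) * T) * ε := by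
        rw [hsa]
        ring
      rw [h12] at h4
      refine h4.trans (mul_le_mul_of_nonneg_right ?_ hε.le)
      linarith
    exact le_of_mul_le_mul_left h11 (by positivity)
  -- Before the switch is passed, either `s ≤ ε / 2` and the first stage alone suffices, or `a` is
  -- bounded below and the assumed `T` exceeds `τ + 1`.
  · rcases le_total (a ^ 2) (1 / 2) with hsmall | hlarge
    · have h2 := errorBound_le_first_stage hμ hG hs hD hTτ
      have h3 : Real.exp (-(T / (2 * G))) * D ≤ ε / 2 := by
        refine exp_neg_mul_le_of_posLog_le hD (by positivity) ?_
        have h4 : Real.posLog (D / (ε / 2)) ≤ 1 + Q := by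
          have e : D / (ε / 2) = 2 * (D / ε) := by field_simp
          rw [e]
          refine Real.posLog_mul.trans ?_
          gcongr
          rw [Real.posLog_eq_log (by norm_num)]
          linarith [Real.log_two_lt_d9]
        refine h4.trans ?_
        rw [le_div_iff₀ (by positivity)]
        nlinarith
      have h5 : s ≤ ε / 2 := by
        rw [hsa]
        nlinarith
      linarith
    · exfalso
      have h1 : 1 / 2 ≤ a := by nlinarith
      have h2 : G * P * (1 / 2) ≤ G * P * a := mul_le_mul_of_nonneg_left h1 hGP
      have h3 : G * (1 / 2) ≤ G * a ^ 2 := mul_le_mul_of_nonneg_left hlarge hG0.le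
      have h4 : (T : ℝ) ≤ (τ + 1 : ℕ) := by exact_mod_cast hTτ
      nlinarith

/-- For small accuracies the lower-order terms of the complexity are absorbed by the leading
ones. -/
theorem eventually_complexity_le (hs : 0 < s) (D : ℝ) : ∀ᶠ ε : ℝ in 𝓝[>] 0,
    s / ε + √s * Real.posLog (D / s) / √ε + Real.posLog (D / ε) + 1
      ≤ 2 * (s / ε + √s * Real.log D / √ε) := by
  set P := Real.posLog (D / s) with hP
  have hP0 : 0 ≤ P := Real.posLog_nonneg
  -- Once `a ≥ N`, the leading `a²` absorbs `a P`, the constants and a possibly negative `2a log D`.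
  -- For `D = 0` the convention `log 0 = 0` applies.
  set N := 2 * (|Real.log D| + P + 2) with hN
  have hN0 : 0 < N := by positivity
  have hmem : Set.Ioo (0 : ℝ) (s / N ^ 2) ∈ 𝓝[>] (0 : ℝ) := Ioo_mem_nhdsGT (by positivity)
  filter_upwards [hmem] with ε hε
  obtain ⟨hε, hεN⟩ := hε
  set a := √s / √ε with ha
  have ha0 : 0 < a := by
    have := Real.sqrt_pos.2 hs
    have := Real.sqrt_pos.2 hε
    positivity
  have ha2 : a ^ 2 = s / ε := by
    rw [ha, div_pow, Real.sq_sqrt hs.le, Real.sq_sqrt hε.le]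
  have haN : N ≤ a := by
    refine (pow_le_pow_iff_left₀ hN0.le ha0.le two_ne_zero).1 ?_
    rw [ha2, le_div_iff₀ hε, mul_comm]
    exact ((lt_div_iff₀ (by positivity)).1 hεN).le
  have hQ : Real.posLog (D / ε) ≤ P + 2 * a := by
    -- Since `ε = s / a²`, subadditivity of `log⁺` trades the logarithm in `ε` for `P` plus a term
    -- linear in `a`.
    have e : D / ε = D / s * (a * a) := by
      rw [← sq, ha2]
      field_simp
    rw [e]
    refine Real.posLog_mul.trans ?_
    have h1 : Real.posLog a ≤ a := by
      refine max_le ha0.le ?_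
      linarith [Real.log_le_sub_one_of_pos ha0]
    linarith [Real.posLog_mul (x := a) (y := a)]
  have e1 : √s * P / √ε = a * P := by rw [ha]; ring
  have e2 : √s * Real.log D / √ε = a * Real.log D := by rw [ha]; ring
  rw [e1, e2, ← ha2]
  have h1 := neg_abs_le (Real.log D)
  have h2 := mul_le_mul_of_nonneg_left haN ha0.le
  have h3 := mul_le_mul_of_nonneg_left h1 ha0.le
  have h4 : 4 ≤ a := by linarith [abs_nonneg (Real.log D)]
  nlinarith [mul_nonneg hP0 (by linarith : 0 ≤ a - 1)]

end Recursion

/-! ### Convergence of the iterates -/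

/-- Positive definiteness of `C_*` keeps `σ_*²` away from zero, so dividing by it in the switching
time is meaningful. -/
theorem sigmaSq_pos {d : ℕ} (hd : 0 < d) {lam : Param d} (hlam : lam ∈ Lam d) (z : E d) :
    0 < sigmaSq lam z := by
  have h1 : 0 < ‖lam.snd‖ := by
    rw [norm_pos_iff]
    intro h0
    have := hlam ⟨0, hd⟩
    rw [h0] at this
    simp at this
  rw [sigmaSq]
  positivity

theorem one_le_g_midpoint {d : ℕ} {φ : Measure ℝ} (hφ : IsBase φ) {μ L : ℝ} (hd : 0 < d)
    (hμ : 0 < μ) (hL : 0 < L) (hμL : μ ≤ L) :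
    1 ≤ g d (((L + μ) / 2) • (1 : Matrix (Fin d) (Fin d) ℝ)) ((L - μ) / 2) μ φ := by
  rw [g_midpoint hd hμ hL]
  have h1 := hφ.one_le_r4
  have h2 : 0 ≤ expMaxSq d φ := expMaxSq_nonneg
  have h3 : 1 ≤ L / μ := (one_le_div hμ).2 hμL
  have h4 : 0 ≤ (L / μ - 1) ^ 2 * (1 / 2 + r4 φ + expMaxSq d φ) :=
    mul_nonneg (sq_nonneg _) (by linarith)
  have h5 : 4 ≤ (L / μ + 1) ^ 2 := by nlinarith
  have h6 : 2 * 4 ≤ (1 + r4 φ) * (L / μ + 1) ^ 2 :=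
    mul_le_mul (by linarith) h5 (by norm_num) (by linarith)
  linarith

theorem meanSquareLipschitz_midpoint {d : ℕ} {l : E d → ℝ} {φ : Measure ℝ} (hφ : IsBase φ)
    {μ L : ℝ} (hd : 0 < d) (hμ : 0 < μ) (hL : 0 < L) (hc : StronglyConvex l μ)
    (hs : Smooth l L) (h2 : TwiceDifferentiable l) :
    MeanSquareLipschitz l φ
      (μ ^ 2 * g d (((L + μ) / 2) • (1 : Matrix (Fin d) (Fin d) ℝ)) ((L - μ) / 2) μ φ) := by
  intro lam lam'
  have h := hφ.integral_norm_reparamGrad_sub_sq_le hs hL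
    (norm_gradient_sub_smul_le hd hμ hL hc hs h2) lam lam'
  refine ⟨h.1, h.2.trans_eq ?_⟩
  congr 1
  rw [g, norm_matOp_smul_one hd (by positivity)]
  field_simp

/-- The iterates of the two-stage schedule obey the bounds of the scalar recursion. -/
theorem guarantee_of_errorBound_le {d : ℕ} {l : E d → ℝ} {h : Param d → EReal} {φ : Measure ℝ}
    {μ L G : ℝ} {z : E d} {lam0 p : Param d} (hφ : IsBase φ) (hs : Smooth l L) (hL : 0 < L)
    (hμ : 0 < μ) (hG : 1 ≤ G) (hA : MeanSquareLipschitz l φ (μ ^ 2 * G))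
    (hz : gradient l z = 0) (hq : HasQuadraticBounds l (gradient l) μ (2 * L))
    (hh : IsRegularizer h) (hp : IsSubgradient h p (-meanGrad l φ p)) {T : ℕ} {s D ε : ℝ}
    (hε : 0 ≤ ε)
    (hT : errorBound μ G (sigmaSq p z) (‖lam0 - p‖ ^ 2)
      (stepSize μ (1 / (2 * μ * G)) (switchTime G s D)) T ≤ ε) :
    Guarantee.{v} l h φ (stepSize μ (1 / (2 * μ * G)) (switchTime G s D)) lam0 p T ε := by
  intro Ω _ P _ u hu hind hlaw
  have hG0 : 0 < G := by linarith
  have hstep := stepSize_switchTime (s := s) (D := D) hμ hG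
  set γ := stepSize μ (1 / (2 * μ * G)) (switchTime G s D) with hγ
  have h1 : ∀ t, 2 * γ t * (μ ^ 2 * G) ≤ μ := by
    intro t
    have h2 := (hstep t).2
    rw [le_div_iff₀ (by positivity)] at h2
    nlinarith
  have h2 : ∀ t, γ t * μ ≤ 1 := by
    intro t
    have h3 := (hstep t).2
    rw [le_div_iff₀ (by positivity)] at h3
    nlinarith [mul_pos (hstep t).1 hμ]
  have hbound := (lintegral_spgd_le (lam0 := lam0) hA hφ hs hL hμ hz hq hh (fun t => (hstep t).1)
    h1 h2 (by positivity) hp (r := errorBound μ G (sigmaSq p z) (‖lam0 - p‖ ^ 2) γ) le_rfl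
    (fun t => le_rfl) hu hind hlaw T).trans (ENNReal.ofReal_le_ofReal hT)
  have hmeas : Measurable fun ω => ‖spgd l h γ lam0 (fun t => u t ω) T - p‖ ^ 2 := by
    have := (measurable_spgd (lam0 := lam0) hs hL hh (fun t => (hstep t).1) T).comp
      (measurable_pi_lambda (fun ω t => u t ω) fun t => hu t)
    exact (this.sub_const p).norm.pow_const 2
  have hint : Integrable (fun ω => ‖spgd l h γ lam0 (fun t => u t ω) T - p‖ ^ 2) P := by
    refine ⟨hmeas.aestronglyMeasurable, ?_⟩
    rw [hasFiniteIntegral_iff_ofReal (Eventually.of_forall fun ω => sq_nonneg _)]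
    exact hbound.trans_lt ENNReal.ofReal_lt_top
  refine ⟨hint, ?_⟩
  rw [← ENNReal.ofReal_le_ofReal_iff hε,
    ofReal_integral_eq_lintegral_ofReal hint (Eventually.of_forall fun ω => sq_nonneg _)]
  exact hbound

end BBVI

end

/-! ### Assembly of the constants -/

theorem mainTheorem7 :
    -- the absolute constant in the `O`-notation
    ∃ K : ℝ, 0 < K ∧
      ∀ (d : ℕ) (l : BBVI.E d → ℝ) (h : BBVI.Param d → EReal) (φ : Measure ℝ) (μ L : ℝ)
        (H : Matrix (Fin d) (Fin d) ℝ) (δ κ : ℝ) (lam0 : BBVI.Param d),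
        0 < d → 0 < μ → 0 < L →
        BBVI.StronglyConvex l μ → BBVI.Smooth l L → BBVI.TwiceDifferentiable l →
        BBVI.IsRegularizer h → BBVI.IsBase φ → lam0 ∈ BBVI.Lam d →
        H = ((L + μ) / 2) • (1 : Matrix (Fin d) (Fin d) ℝ) → δ = (L - μ) / 2 → κ = L / μ →
        -- the hypotheses on the Hessian hold with these `H` and `δ`
        BBVI.AlmostConstantHessian l H δ ∧
        (∀ v : BBVI.E d, μ * ‖v‖ ≤ ‖BBVI.matOp H v‖ ∧ ‖BBVI.matOp H v‖ ≤ L * ‖v‖) ∧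
        -- the value of `g`
        BBVI.g d H δ μ φ = 1 / 2 * (1 + BBVI.r4 φ) * (κ + 1) ^ 2
          + (κ - 1) ^ 2 * (1 / 2 + BBVI.r4 φ + BBVI.expMaxSq d φ) ∧
        -- the proximal operator is well defined
        (∀ γ : ℝ, 0 < γ → ∀ x : BBVI.Param d,
          BBVI.IsUniqueArgmin (BBVI.proxObj h γ x) (BBVI.Lam d) (BBVI.prox h γ x)) ∧
        -- the iteration complexity
        ∃ (lamStar : BBVI.Param d) (zbar : BBVI.E d),
          BBVI.IsUniqueArgmin (BBVI.F l h φ) (BBVI.Lam d) lamStar ∧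
          BBVI.IsUniqueArgmin l Set.univ zbar ∧
          ∃ (Lc γ0 : ℝ) (tstar : ℕ),
            0 < Lc ∧ BBVI.ExpectedSmooth l φ Lc ∧ 0 < γ0 ∧ γ0 ≤ μ / (2 * Lc ^ 2) ∧
            -- for every accuracy, with all lower-order terms
            (∀ ε : ℝ, 0 < ε → ∀ T : ℕ,
              K * (BBVI.g d H δ μ φ *
                (BBVI.sigmaSq lamStar zbar / ε
                  + √(BBVI.sigmaSq lamStar zbar)
                      * Real.posLog (‖lam0 - lamStar‖ ^ 2 / BBVI.sigmaSq lamStar zbar) / √ε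
                  + Real.posLog (‖lam0 - lamStar‖ ^ 2 / ε) + 1)) ≤ T →
              BBVI.Guarantee.{v} l h φ (BBVI.stepSize μ γ0 tstar) lam0 lamStar T ε) ∧
            -- for all sufficiently small accuracies, with the leading terms only
            (∀ᶠ ε : ℝ in 𝓝[>] 0, ∀ T : ℕ,
              K * (BBVI.g d H δ μ φ *
                (BBVI.sigmaSq lamStar zbar / ε
                  + √(BBVI.sigmaSq lamStar zbar)
                      * Real.log (‖lam0 - lamStar‖ ^ 2) / √ε)) ≤ T →
              BBVI.Guarantee.{v} l h φ (BBVI.stepSize μ γ0 tstar) lam0 lamStar T ε) := by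
  -- `16` comes from `errorBound_le_of_le`; the factor `2` is lost when lower-order terms are
  -- absorbed for small `ε`.
  refine ⟨32, by norm_num, ?_⟩
  rintro d l h φ μ L H δ κ lam0 hd hμ hL hc hs h2 hh hφ - rfl rfl rfl
  have hμL : μ ≤ L := hc.le_of_smooth hμ hs hd
  have hq := hc.hasQuadraticBounds hμ hs
  obtain ⟨z, hzmin, hz⟩ := hc.exists_isUniqueArgmin hμ hs
  have hA := BBVI.meanSquareLipschitz_midpoint hφ hd hμ hL hc hs h2
  have hG := BBVI.one_le_g_midpoint hφ hd hμ hL hμL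
  refine ⟨BBVI.almostConstantHessian_midpoint hd hμ hL hc hs h2, fun v => ?_,
    BBVI.g_midpoint hd hμ hL φ, fun γ hγ x => (hh.prox_spec hγ x).1, ?_⟩
  · rw [BBVI.matOp_smul_one_apply, norm_smul, Real.norm_of_nonneg (by positivity)]
    constructor <;> gcongr <;> linarith
  set G := BBVI.g d (((L + μ) / 2) • (1 : Matrix (Fin d) (Fin d) ℝ)) ((L - μ) / 2) μ φ
  have hG0 : 0 < G := by linarith
  have hf := hA.hasQuadraticBounds_f hφ hs hL hμ hz hq
  obtain ⟨p, hp⟩ := hh.isClosedConvex.exists_isSubgradient hf hμ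
  have hpmin : BBVI.IsUniqueArgmin (BBVI.F l h φ) (BBVI.Lam d) p := by
    have e : BBVI.F l h φ = fun y => h y + (BBVI.f l φ y : EReal) :=
      funext fun y => add_comm _ _
    rw [e]
    exact hh.isUniqueArgmin hf hμ hp
  have hσ := BBVI.sigmaSq_pos hd hpmin.1 z
  set s := BBVI.sigmaSq p z with hs_def
  set D := ‖lam0 - p‖ ^ 2 with hD_def
  have hD : 0 ≤ D := sq_nonneg _
  have hLc : (μ * √G) ^ 2 = μ ^ 2 * G := by rw [mul_pow, Real.sq_sqrt hG0.le]
  have main : ∀ ε : ℝ, 0 < ε → ∀ T : ℕ,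
      16 * (G * (s / ε + √s * Real.posLog (D / s) / √ε + Real.posLog (D / ε) + 1)) ≤ T →
      BBVI.Guarantee.{v} l h φ
        (BBVI.stepSize μ (1 / (2 * μ * G)) (BBVI.switchTime G s D)) lam0 p T ε :=
    fun ε hε T hT => BBVI.guarantee_of_errorBound_le hφ hs hL hμ hG hA hz hq hh hp hε.le
      (BBVI.errorBound_le_of_le hμ hG hσ hD hε hT)
  -- With `𝓛 = μ√g` the step `1 / (2μg)` equals `μ / (2𝓛²)`, the largest one allowed.
  refine ⟨p, z, hpmin, hzmin, μ * √G, 1 / (2 * μ * G), BBVI.switchTime G s D, by positivity,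
    ?_, by positivity, ?_, ?_, ?_⟩
  · intro lam _ lam' _
    rw [hLc]
    exact hA lam lam'
  · rw [hLc]
    exact (by field_simp : 1 / (2 * μ * G) = μ / (2 * (μ ^ 2 * G))).le
  · intro ε hε T hT
    refine main ε hε T (le_trans ?_ hT)
    have hP : 0 ≤ Real.posLog (D / s) := Real.posLog_nonneg
    have hQ : 0 ≤ Real.posLog (D / ε) := Real.posLog_nonneg
    gcongr
    norm_num
  · filter_upwards [BBVI.eventually_complexity_le hσ D, self_mem_nhdsWithin] with ε hε hε0 T hT
    refine main ε hε0 T (le_trans ?_ hT)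
    have := mul_le_mul_of_nonneg_left hε hG0.le
    linarith
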